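/- **Theorem 4.1.** Let $d\ge 1$ be an integer, let $s\ge d$ be real, and let $U^d=[0,1]^d\subset\mathbb{R}^d$. For a finite set $\omega\subset\mathbb{R}^d$ put $$E_s(\omega)=\sum_{\substack{x,y\in\omega\\ x\ne y}}\frac{1}{|x-y|^{s}}$$ (sum over ordered pairs, $|\cdot|$ the Euclidean norm), and for $A\subset\mathbb{R}^d$ and $N\in\mathbb{N}$ let $$\mathcal{E}_s(A,N)=\inf\{E_s(\omega):\ \omega\subset A,\ \omega \text{ has exactly } N \text{ points}\},$$ with $\inf\emptyset=\infty$. Let $\tau_{s,d}(N)=N^{1+s/d}$ if $s>d$, and $\tau_{s,d}(N)=N^2\log N$ if $s=d$. Then the limit $$g_{s,d}(U^d)=\lim_{N\to\infty}\frac{\mathcal{E}_s(U^d,N)}{\tau_{s,d}(N)}$$ exists and is finite and positive. Moreover, in the case $s=d$, $$g_{d,d}(U^d)=\mathcal{H}_d(\mathcal{B}^d)=\frac{2\pi^{d/2}}{d\,\Gamma(d/2)},$$ where $\mathcal{B}^d$ is the closed unit ball of $\mathbb{R}^d$ and $\mathcal{H}_d$ is $d$-dimensional Hausdorff measure normalized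 so that $\mathcal{H}_d([0,1]^d)=1$. -/

import Mathlib

open MeasureTheory Filter Topology
open scoped ENNReal

noncomputable section

/-- The Riesz `s`-energy of a finite set of (distinct) points of `ℝ^p`, the sum running over all
ordered pairs of different points. It is zero for sets with at most one point. -/
def rieszEnergy {p : ℕ} (s : ℝ) (ω : Finset (EuclideanSpace ℝ (Fin p))) : ℝ :=
  ∑ y ∈ ω, ∑ x ∈ ω with x ≠ y, 1 / ‖x - y‖ ^ s

/-- Energies are nonnegative, so passing to `ℝ≥0∞` below loses nothing. -/
theorem rieszEnergy_nonneg {p : ℕ} (s : ℝ) (ω : Finset (EuclideanSpace ℝ (Fin p))) :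
    0 ≤ rieszEnergy s ω :=
  Finset.sum_nonneg fun _ _ => Finset.sum_nonneg fun _ _ =>
    one_div_nonneg.2 (Real.rpow_nonneg (norm_nonneg _) s)

/-- The `N`-point minimal `s`-energy over `A ⊆ ℝ^p`; it is `∞` if `A` has fewer than `N` points. -/
def minEnergy {p : ℕ} (s : ℝ) (A : Set (EuclideanSpace ℝ (Fin p))) (N : ℕ) : ℝ≥0∞ :=
  ⨅ (ω : Finset (EuclideanSpace ℝ (Fin p))) (_ : (ω : Set (EuclideanSpace ℝ (Fin p))) ⊆ A)
    (_ : ω.card = N), ENNReal.ofReal (rieszEnergy s ω)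

/-- The normalization: `N ^ (1 + s / d)` for `s > d` and `N ^ 2 * log N` for `s = d`.
It is only used for `s ≥ d`. -/
def tau (s : ℝ) (d : ℕ) (N : ℕ) : ℝ :=
  if (d : ℝ) < s then (N : ℝ) ^ (1 + s / (d : ℝ)) else (N : ℝ) ^ 2 * Real.log (N : ℝ)

/-- The normalized minimal energy. -/
def normalizedMinEnergy {p : ℕ} (s : ℝ) (d : ℕ) (A : Set (EuclideanSpace ℝ (Fin p))) (N : ℕ) :
    ℝ≥0∞ :=
  minEnergy s A N / ENNReal.ofReal (tau s d N)

/-- The unit cube `[0,1]^d` in `ℝ^d`. -/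
def unitCube (d : ℕ) : Set (EuclideanSpace ℝ (Fin d)) :=
  {x | ∀ i, x i ∈ Set.Icc (0 : ℝ) 1}

end

/-! Lower bounds come from the positive definiteness of the Gaussian. The double sum of
exp(-t|x-y|²) over a configuration is, up to a constant, the squared L² norm of a sum of narrower
Gaussians. Cauchy-Schwarz on a slightly enlarged cube bounds it below by (1-η)(π/t)^(d/2) N² for t ≥
T, with T independent of N (`exists_sum_gaussian_ge`). For s = d, integrating this against t^(d/2-1)
over [T, N^(2/d)] turns Gaussians into Riesz kernels and yields N² log N with the sharp constant
(`rieszEnergy_critical_ge`). For s > d a single well-chosen t gives the order N^(1+s/d)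
(`rieszEnergy_supercritical_ge`).

Upper bounds come from placing a copy of a configuration, shrunk by γ/m, in each of the m^d cells of
the cube (`exists_rieszEnergy_copies_le`). The interaction between different cells is controlled by
a truncated Epstein zeta sum. This sum is bounded when s > d; when s = d it is at most the area of
the unit sphere times log n, up to O(1).

For s = d, copies of a single point, that is a grid, already match the lower bound. For s > d, write
a_N for the normalized energy: copying near-minimizers with N points gives limsup a ≤ a_N/γ^s +
O_γ(N^(1-s/d)). Letting N → ∞ and then γ → 1 yields limsup ≤ liminf, so the limit exists. -/

/-! ### Gaussian energy of points in the cube: the uniform lower bound. -/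

section GaussianKernel

variable {d : ℕ}

theorem integrable_gaussian {b : ℝ} (hb : 0 < b) (x : EuclideanSpace ℝ (Fin d)) :
    Integrable (fun z : EuclideanSpace ℝ (Fin d) => Real.exp (-b * ‖z - x‖ ^ 2)) := by
  have h : Integrable (fun z : EuclideanSpace ℝ (Fin d) => Real.exp (-b * ‖z‖ ^ 2)) := by
    refine .of_integral_ne_zero ?_
    rw [GaussianFourier.integral_rexp_neg_mul_sq_norm hb]
    have := Real.pi_pos
    positivity
  exact h.comp_sub_right x

theorem integral_gaussian_sub {b : ℝ} (hb : 0 < b) (x : EuclideanSpace ℝ (Fin d)) :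
    ∫ z : EuclideanSpace ℝ (Fin d), Real.exp (-b * ‖z - x‖ ^ 2) =
      (Real.pi / b) ^ ((d : ℝ) / 2) := by
  rw [integral_sub_right_eq_self (fun z : EuclideanSpace ℝ (Fin d) => Real.exp (-b * ‖z‖ ^ 2)) x,
    GaussianFourier.integral_rexp_neg_mul_sq_norm hb, finrank_euclideanSpace_fin]

/-- Completing the square about the midpoint of x and y, via the parallelogram law. Integrating in z
exhibits exp(-t|x-y|²) as an L² inner product of two translated Gaussians. -/
theorem gaussian_mul_gaussian (t : ℝ) (x y z : EuclideanSpace ℝ (Fin d)) :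
    Real.exp (-(2 * t) * ‖z - x‖ ^ 2) * Real.exp (-(2 * t) * ‖z - y‖ ^ 2) =
      Real.exp (-t * ‖x - y‖ ^ 2) *
        Real.exp (-(4 * t) * ‖z - (2⁻¹ : ℝ) • (x + y)‖ ^ 2) := by
  rw [← Real.exp_add, ← Real.exp_add]
  have h := parallelogram_law_with_norm ℝ (z - x) (z - y)
  have h1 : z - x + (z - y) = (2 : ℝ) • (z - (2⁻¹ : ℝ) • (x + y)) := by
    rw [smul_sub, smul_smul, two_smul]; norm_num; abel
  have h2 : z - x - (z - y) = -(x - y) := by abel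
  rw [h1, h2, norm_neg, norm_smul, Real.norm_ofNat] at h
  congr 1
  linear_combination t * h

theorem integrable_gaussian_mul {t : ℝ} (ht : 0 < t) (x y : EuclideanSpace ℝ (Fin d)) :
    Integrable (fun z : EuclideanSpace ℝ (Fin d) =>
      Real.exp (-(2 * t) * ‖z - x‖ ^ 2) * Real.exp (-(2 * t) * ‖z - y‖ ^ 2)) := by
  simp only [gaussian_mul_gaussian]
  exact (integrable_gaussian (by positivity) _).const_mul _

theorem integral_gaussian_mul {t : ℝ} (ht : 0 < t) (x y : EuclideanSpace ℝ (Fin d)) :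
    ∫ z : EuclideanSpace ℝ (Fin d),
      Real.exp (-(2 * t) * ‖z - x‖ ^ 2) * Real.exp (-(2 * t) * ‖z - y‖ ^ 2) =
      Real.exp (-t * ‖x - y‖ ^ 2) * (Real.pi / (4 * t)) ^ ((d : ℝ) / 2) := by
  simp only [gaussian_mul_gaussian]
  rw [integral_const_mul, integral_gaussian_sub (by positivity)]

/-- The cube `[-δ, 1 + δ]^d`. -/
def thickCube (d : ℕ) (δ : ℝ) : Set (EuclideanSpace ℝ (Fin d)) :=
  WithLp.ofLp ⁻¹' Set.Icc (fun _ => -δ) (fun _ => 1 + δ)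

theorem measurableSet_thickCube (d : ℕ) (δ : ℝ) : MeasurableSet (thickCube d δ) :=
  (PiLp.volume_preserving_ofLp (Fin d)).measurable measurableSet_Icc

theorem volume_thickCube (d : ℕ) {δ : ℝ} (hδ : 0 ≤ δ) :
    volume (thickCube d δ) = ENNReal.ofReal ((1 + 2 * δ) ^ d) := by
  rw [thickCube, (PiLp.volume_preserving_ofLp (Fin d)).measure_preimage
    measurableSet_Icc.nullMeasurableSet, Real.volume_Icc_pi]
  simp only [Finset.prod_const, Finset.card_univ, Fintype.card_fin]
  rw [← ENNReal.ofReal_pow (by linarith)]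
  congr 2
  ring

theorem le_norm_sub_of_notMem_thickCube {δ : ℝ} {x z : EuclideanSpace ℝ (Fin d)}
    (hx : x ∈ unitCube d) (hz : z ∉ thickCube d δ) : δ ≤ ‖z - x‖ := by
  contrapose! hz
  have h : ∀ i, |z i - x i| < δ := fun i => (PiLp.norm_apply_le (z - x) i).trans_lt hz
  refine ⟨fun i => ?_, fun i => ?_⟩
  · have := (abs_lt.1 (h i)).1
    have := (hx i).1
    show -δ ≤ z i
    linarith
  · have := (abs_lt.1 (h i)).2
    have := (hx i).2
    show z i ≤ 1 + δ
    linarith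

/-- Most of the mass of a narrow Gaussian centred in the unit cube stays close to the cube. -/
theorem setIntegral_gaussian_ge {δ t : ℝ} (hδ : 0 ≤ δ) (ht : 0 < t)
    {x : EuclideanSpace ℝ (Fin d)} (hx : x ∈ unitCube d) :
    (Real.pi / (2 * t)) ^ ((d : ℝ) / 2) *
        (1 - 2 ^ ((d : ℝ) / 2) * Real.exp (-t * δ ^ 2)) ≤
      ∫ z in thickCube d δ, Real.exp (-(2 * t) * ‖z - x‖ ^ 2) := by
  have h2t : 0 < 2 * t := by positivity
  have hpi := Real.pi_pos
  have hsplit := integral_add_compl (measurableSet_thickCube d δ) (integrable_gaussian h2t x)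
  rw [integral_gaussian_sub h2t] at hsplit
  have htail : ∫ z in (thickCube d δ)ᶜ, Real.exp (-(2 * t) * ‖z - x‖ ^ 2) ≤
      Real.exp (-t * δ ^ 2) * (Real.pi / t) ^ ((d : ℝ) / 2) := by
    rw [← integral_gaussian_sub ht x, ← integral_const_mul]
    have hint := (integrable_gaussian ht x).const_mul (Real.exp (-t * δ ^ 2))
    -- Half of the exponent 2t|z-x|² is spent on the decay factor, since |z-x| ≥ δ off the thick
    -- cube; the other half keeps the integral finite.
    calc _ ≤ ∫ z in (thickCube d δ)ᶜ, Real.exp (-t * δ ^ 2) * Real.exp (-t * ‖z - x‖ ^ 2) := by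
          refine setIntegral_mono_on (integrable_gaussian h2t x).integrableOn hint.integrableOn
            (measurableSet_thickCube d δ).compl fun z hz => ?_
          rw [← Real.exp_add, Real.exp_le_exp]
          have h := le_norm_sub_of_notMem_thickCube hx hz
          have : δ ^ 2 ≤ ‖z - x‖ ^ 2 := by gcongr
          nlinarith
      _ ≤ _ := setIntegral_le_integral hint (ae_of_all _ fun z => by positivity)
  have hscale : (Real.pi / t) ^ ((d : ℝ) / 2) =
      2 ^ ((d : ℝ) / 2) * (Real.pi / (2 * t)) ^ ((d : ℝ) / 2) := by
    rw [← Real.mul_rpow (by positivity) (by positivity)]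
    congr 1
    field_simp
  rw [hscale] at htail
  linarith

/-- Positive definiteness of the Gaussian in quantitative form: the Cauchy-Schwarz inequality on
a set `A` for the sum of Gaussians centred at the points of `ω`. -/
theorem sq_setIntegral_sum_gaussian_le {t : ℝ} (ht : 0 < t)
    (ω : Finset (EuclideanSpace ℝ (Fin d))) {A : Set (EuclideanSpace ℝ (Fin d))}
    (hA' : volume A ≠ ∞) :
    (∑ x ∈ ω, ∫ z in A, Real.exp (-(2 * t) * ‖z - x‖ ^ 2)) ^ 2 ≤
      (volume A).toReal * ((Real.pi / (4 * t)) ^ ((d : ℝ) / 2) *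
        ∑ x ∈ ω, ∑ y ∈ ω, Real.exp (-t * ‖x - y‖ ^ 2)) := by
  have h2t : 0 < 2 * t := by positivity
  have hpi := Real.pi_pos
  set F : EuclideanSpace ℝ (Fin d) → ℝ := fun z => ∑ x ∈ ω, Real.exp (-(2 * t) * ‖z - x‖ ^ 2)
  have hF : Integrable F := integrable_finsetSum _ fun x _ => integrable_gaussian h2t x
  have hF2e : (fun z => F z ^ 2) = fun z => ∑ x ∈ ω, ∑ y ∈ ω,
      Real.exp (-(2 * t) * ‖z - x‖ ^ 2) * Real.exp (-(2 * t) * ‖z - y‖ ^ 2) := by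
    ext z
    rw [sq, Finset.sum_mul_sum]
  have hF2 : Integrable (fun z => F z ^ 2) := by
    rw [hF2e]
    exact integrable_finsetSum _ fun x _ => integrable_finsetSum _ fun y _ =>
      integrable_gaussian_mul ht x y
  have hI2 : ∫ z, F z ^ 2 = (Real.pi / (4 * t)) ^ ((d : ℝ) / 2) *
      ∑ x ∈ ω, ∑ y ∈ ω, Real.exp (-t * ‖x - y‖ ^ 2) := by
    rw [hF2e, integral_finsetSum _ fun x _ => integrable_finsetSum _ fun y _ =>
      integrable_gaussian_mul ht x y, Finset.mul_sum]
    refine Finset.sum_congr rfl fun x _ => ?_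
    rw [integral_finsetSum _ fun y _ => integrable_gaussian_mul ht x y, Finset.mul_sum]
    refine Finset.sum_congr rfl fun y _ => ?_
    rw [integral_gaussian_mul ht, mul_comm]
  have hI1 : ∑ x ∈ ω, ∫ z in A, Real.exp (-(2 * t) * ‖z - x‖ ^ 2) = ∫ z in A, F z :=
    (integral_finsetSum _ fun x _ => (integrable_gaussian h2t x).integrableOn).symm
  rw [hI1, ← hI2]
  set I := ∫ z in A, F z
  set v := (volume A).toReal with hv
  have hle : ∫ z in A, F z ^ 2 ≤ ∫ z, F z ^ 2 :=
    setIntegral_le_integral hF2 (ae_of_all _ fun z => by positivity)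
  -- Cauchy-Schwarz in its quadratic form: integrate (F - c)² ≥ 0 over A. The optimal c is the mean
  -- I / v, used below when v > 0.
  have hquad : ∀ c : ℝ, 2 * c * I - c ^ 2 * v ≤ ∫ z, F z ^ 2 := by
    intro c
    refine le_trans ?_ hle
    have hc : IntegrableOn (fun _ : EuclideanSpace ℝ (Fin d) => c ^ 2) A :=
      integrableOn_const hA'
    have : ∫ z in A, (2 * c * F z - c ^ 2) = 2 * c * I - c ^ 2 * v := by
      rw [integral_sub (hF.integrableOn.const_mul _) hc, integral_const_mul, setIntegral_const,
        Measure.real, smul_eq_mul, mul_comm v]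
    rw [← this]
    refine integral_mono ((hF.integrableOn.const_mul _).sub hc) hF2.integrableOn fun z => ?_
    show 2 * c * F z - c ^ 2 ≤ F z ^ 2
    nlinarith [sq_nonneg (F z - c)]
  have hv0 : 0 ≤ v := ENNReal.toReal_nonneg
  rcases hv0.eq_or_lt with h0 | hpos
  · have : I = 0 := by
      refine setIntegral_measure_zero _ ?_
      rcases (ENNReal.toReal_eq_zero_iff _).1 h0.symm with h | h
      exacts [h, absurd h hA']
    rw [this, ← h0]
    simp
  · have := hquad (I / v)
    have h2 : 2 * (I / v) * I - (I / v) ^ 2 * v = I ^ 2 / v := by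
      field_simp
      ring
    rw [h2, div_le_iff₀ hpos] at this
    linarith

/-- Each Gaussian keeps a share at least q of its mass in the thick cube, so Cauchy-Schwarz there
loses only q² and the volume (1+2δ)^d. Both losses tend to 1 as t → ∞ and then δ → 0. -/
theorem sum_gaussian_ge_of_thickCube {δ t : ℝ} (hδ : 0 ≤ δ) (ht : 0 < t)
    (hsmall : 2 ^ ((d : ℝ) / 2) * Real.exp (-t * δ ^ 2) ≤ 1)
    (ω : Finset (EuclideanSpace ℝ (Fin d))) (hω : (ω : Set _) ⊆ unitCube d) :
    (1 - 2 ^ ((d : ℝ) / 2) * Real.exp (-t * δ ^ 2)) ^ 2 / (1 + 2 * δ) ^ d *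
        ((Real.pi / t) ^ ((d : ℝ) / 2) * (ω.card : ℝ) ^ 2) ≤
      ∑ x ∈ ω, ∑ y ∈ ω, Real.exp (-t * ‖x - y‖ ^ 2) := by
  have hpi := Real.pi_pos
  set q := 1 - 2 ^ ((d : ℝ) / 2) * Real.exp (-t * δ ^ 2)
  have hq : 0 ≤ q := by linarith
  set S := ∑ x ∈ ω, ∑ y ∈ ω, Real.exp (-t * ‖x - y‖ ^ 2)
  have hvol := volume_thickCube d hδ
  have h := sq_setIntegral_sum_gaussian_le ht ω (A := thickCube d δ)
    (by rw [hvol]; exact ENNReal.ofReal_ne_top)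
  rw [hvol, ENNReal.toReal_ofReal (by positivity)] at h
  have hlow : (ω.card : ℝ) * ((Real.pi / (2 * t)) ^ ((d : ℝ) / 2) * q) ≤
      ∑ x ∈ ω, ∫ z in thickCube d δ, Real.exp (-(2 * t) * ‖z - x‖ ^ 2) := by
    rw [← nsmul_eq_mul]
    exact Finset.card_nsmul_le_sum _ _ _ fun x hx => setIntegral_gaussian_ge hδ ht (hω hx)
  have h2 : ((ω.card : ℝ) * ((Real.pi / (2 * t)) ^ ((d : ℝ) / 2) * q)) ^ 2 ≤ _ :=
    (pow_le_pow_left₀ (by positivity) hlow 2).trans h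
  have hsq : ((Real.pi / (2 * t)) ^ ((d : ℝ) / 2)) ^ 2 =
      (Real.pi / t) ^ ((d : ℝ) / 2) * (Real.pi / (4 * t)) ^ ((d : ℝ) / 2) := by
    rw [sq, ← Real.mul_rpow (by positivity) (by positivity),
      ← Real.mul_rpow (by positivity) (by positivity)]
    congr 1
    field_simp
    norm_num
  rw [mul_pow, mul_pow, hsq] at h2
  have hpos : 0 < (Real.pi / (4 * t)) ^ ((d : ℝ) / 2) := by positivity
  have hδ' : 0 < (1 + 2 * δ) ^ d := by positivity
  rw [div_mul_eq_mul_div, div_le_iff₀ hδ']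
  refine le_of_mul_le_mul_right ?_ hpos
  linarith

/-- The Gaussian energy of `N` points of the unit cube is asymptotically at least that of the
uniform distribution, uniformly in `N`. -/
theorem exists_sum_gaussian_ge (d : ℕ) {η : ℝ} (hη : 0 < η) :
    ∃ T : ℝ, 0 < T ∧ ∀ t, T ≤ t → ∀ ω : Finset (EuclideanSpace ℝ (Fin d)),
      (ω : Set _) ⊆ unitCube d →
        (1 - η) * ((Real.pi / t) ^ ((d : ℝ) / 2) * (ω.card : ℝ) ^ 2) ≤
          ∑ x ∈ ω, ∑ y ∈ ω, Real.exp (-t * ‖x - y‖ ^ 2) := by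
  have hpi := Real.pi_pos
  -- First δ is fixed to make the volume loss small; T then depends on δ through the Gaussian tail.
  obtain ⟨δ, hδ, hδ'⟩ : ∃ δ : ℝ, 0 < δ ∧ 1 - η < 1 / (1 + 2 * δ) ^ d := by
    have hc : Tendsto (fun δ : ℝ => 1 / (1 + 2 * δ) ^ d) (𝓝[>] 0) (𝓝 (1 / (1 + 2 * 0) ^ d)) := by
      refine Tendsto.mono_left (ContinuousAt.tendsto ?_) nhdsWithin_le_nhds
      refine ContinuousAt.div (by fun_prop) (by fun_prop) (by simp)
    have := hc.eventually (lt_mem_nhds (show 1 - η < 1 / (1 + 2 * 0) ^ d by simp; linarith))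
    obtain ⟨δ, h1, h2⟩ := (this.and self_mem_nhdsWithin).exists
    exact ⟨δ, h2, h1⟩
  have hexp : Tendsto (fun t : ℝ => 2 ^ ((d : ℝ) / 2) * Real.exp (-t * δ ^ 2)) atTop (𝓝 0) := by
    have h1 : Tendsto (fun t : ℝ => t * δ ^ 2) atTop atTop :=
      tendsto_id.atTop_mul_const (by positivity)
    have := (Real.tendsto_exp_neg_atTop_nhds_zero.comp h1).const_mul (2 ^ ((d : ℝ) / 2))
    simpa [Function.comp_def] using this
  have hq : Tendsto (fun t : ℝ => (1 - 2 ^ ((d : ℝ) / 2) * Real.exp (-t * δ ^ 2)) ^ 2 /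
      (1 + 2 * δ) ^ d) atTop (𝓝 (1 / (1 + 2 * δ) ^ d)) := by
    have := ((hexp.const_sub 1).pow 2).div_const ((1 + 2 * δ) ^ d)
    simpa using this
  have hev := (hq.eventually (lt_mem_nhds hδ')).and
    ((hexp.eventually (gt_mem_nhds one_pos)).and (eventually_gt_atTop 0))
  obtain ⟨T, hT⟩ := eventually_atTop.1 hev
  refine ⟨T, (hT T le_rfl).2.2, fun t ht ω hω => ?_⟩
  obtain ⟨h1, h2, h3⟩ := hT t ht
  refine le_trans ?_ (sum_gaussian_ge_of_thickCube hδ.le h3 h2.le ω hω)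
  gcongr

end GaussianKernel

/-! ### From Gaussian sums to lower bounds for the Riesz energy. -/

section EnergyLowerBounds

variable {d : ℕ}

theorem sum_gaussian_eq_card_add (t : ℝ) (ω : Finset (EuclideanSpace ℝ (Fin d))) :
    ∑ x ∈ ω, ∑ y ∈ ω, Real.exp (-t * ‖x - y‖ ^ 2) =
      ω.card + ∑ y ∈ ω, ∑ x ∈ ω with x ≠ y, Real.exp (-t * ‖x - y‖ ^ 2) := by
  classical
  rw [Finset.sum_comm, Finset.cast_card, ← Finset.sum_add_distrib]
  refine Finset.sum_congr rfl fun y hy => ?_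
  rw [← Finset.sum_filter_add_sum_filter_not ω (fun x => x = y), Finset.filter_eq' ω y,
    if_pos hy]
  simp

/-- Raise x ≤ exp x, at x = u / a, to the power a. -/
theorem rpow_mul_exp_neg_le {a : ℝ} (ha : 0 < a) {u : ℝ} (hu : 0 < u) :
    Real.exp (-u) ≤ a ^ a / u ^ a := by
  have h1 : u / a ≤ Real.exp (u / a) := by linarith [Real.add_one_le_exp (u / a)]
  have h2 : (u / a) ^ a ≤ Real.exp (u / a) ^ a := by gcongr
  rw [← Real.exp_mul, div_mul_cancel₀ _ ha.ne', Real.div_rpow hu.le ha.le,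
    div_le_iff₀ (by positivity)] at h2
  rw [le_div_iff₀ (by positivity), Real.exp_neg, inv_mul_le_iff₀ (Real.exp_pos _)]
  exact h2

theorem integrableOn_gamma_kernel {a r : ℝ} (ha : 0 < a) (hr : 0 < r) :
    IntegrableOn (fun t : ℝ => t ^ (a - 1) * Real.exp (-t * r ^ 2)) (Set.Ioi 0) := by
  have h := integrableOn_rpow_mul_exp_neg_mul_rpow (p := 1) (s := a - 1) (b := r ^ 2)
    (by linarith) one_pos (by positivity)
  refine h.congr_fun (fun t _ => ?_) measurableSet_Ioi
  simp only [Real.rpow_one]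
  ring_nf

/-- The Riesz kernel as a mixture of Gaussians, which transfers Gaussian bounds to Riesz sums with
exponent 2a. -/
theorem integral_gamma_kernel {a r : ℝ} (ha : 0 < a) (hr : 0 < r) :
    ∫ t in Set.Ioi (0 : ℝ), t ^ (a - 1) * Real.exp (-t * r ^ 2) =
      Real.Gamma a * (1 / r ^ (2 * a)) := by
  have h := Real.integral_rpow_mul_exp_neg_mul_Ioi ha (show 0 < r ^ 2 by positivity)
  rw [Real.rpow_mul hr.le, Real.rpow_two, ← Real.one_rpow a, ← Real.div_rpow zero_le_one
    (by positivity), Real.one_rpow, mul_comm, ← h]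
  refine setIntegral_congr_fun measurableSet_Ioi fun t _ => ?_
  ring_nf

theorem norm_sub_pos_of_mem_filter {ω : Finset (EuclideanSpace ℝ (Fin d))}
    {x y : EuclideanSpace ℝ (Fin d)} (hx : x ∈ ω.filter (fun x => x ≠ y)) : 0 < ‖x - y‖ :=
  norm_sub_pos_iff.2 (Finset.mem_filter.1 hx).2

/-- Integrate the Gaussian bound, minus its diagonal N, against t^(d/2-1). The main term becomes a
multiple of ∫ dt/t. At the cutoff R = N^(2/d) the diagonal catches up with the main term, and up to
there it costs only O(N²), negligible against N² log N. -/
theorem rieszEnergy_critical_ge (hd : 1 ≤ d) {η T : ℝ} (hT : 0 < T)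
    (hgauss : ∀ t, T ≤ t → ∀ ω : Finset (EuclideanSpace ℝ (Fin d)),
      (ω : Set _) ⊆ unitCube d →
        (1 - η) * ((Real.pi / t) ^ ((d : ℝ) / 2) * (ω.card : ℝ) ^ 2) ≤
          ∑ x ∈ ω, ∑ y ∈ ω, Real.exp (-t * ‖x - y‖ ^ 2))
    (ω : Finset (EuclideanSpace ℝ (Fin d))) (hω : (ω : Set _) ⊆ unitCube d)
    (hN : T ≤ (ω.card : ℝ) ^ (2 / (d : ℝ))) (hN0 : 0 < ω.card) :
    (1 - η) * Real.pi ^ ((d : ℝ) / 2) * (ω.card : ℝ) ^ 2 *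
        (2 / d * Real.log ω.card - Real.log T) - 2 / d * (ω.card : ℝ) ^ 2 ≤
      Real.Gamma ((d : ℝ) / 2) * rieszEnergy d ω := by
  have hpi := Real.pi_pos
  have hd0 : (0 : ℝ) < d := by exact_mod_cast hd
  have hN0' : (0 : ℝ) < ω.card := by exact_mod_cast hN0
  set a : ℝ := (d : ℝ) / 2 with ha
  have ha0 : 0 < a := by positivity
  set N : ℝ := (ω.card : ℝ) with hNdef
  set R : ℝ := N ^ (2 / (d : ℝ)) with hR
  have hR0 : 0 < R := by positivity
  have hRa : R ^ a = N := by
    rw [hR, ← Real.rpow_mul hN0'.le]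
    have : 2 / (d : ℝ) * a = 1 := by rw [ha]; field_simp
    rw [this, Real.rpow_one]
  have hlogR : Real.log R = 2 / d * Real.log N := Real.log_rpow hN0' _
  have hsub : Set.Ioc T R ⊆ Set.Ioi 0 := fun t ht => hT.trans ht.1
  have hpair : ∀ y ∈ ω, ∀ x ∈ ω.filter (fun x => x ≠ y),
      IntegrableOn (fun t : ℝ => t ^ (a - 1) * Real.exp (-t * ‖x - y‖ ^ 2)) (Set.Ioc T R) :=
    fun y _ x hx => (integrableOn_gamma_kernel ha0 (norm_sub_pos_of_mem_filter hx)).mono_set hsub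
  have hsumint : ∀ y ∈ ω, IntegrableOn (fun t : ℝ => ∑ x ∈ ω with x ≠ y,
      t ^ (a - 1) * Real.exp (-t * ‖x - y‖ ^ 2)) (Set.Ioc T R) :=
    fun y hy => integrable_finsetSum _ (hpair y hy)
  have hup : ∫ t in Set.Ioc T R, ∑ y ∈ ω, ∑ x ∈ ω with x ≠ y,
      t ^ (a - 1) * Real.exp (-t * ‖x - y‖ ^ 2) ≤ Real.Gamma a * rieszEnergy d ω := by
    rw [integral_finsetSum _ hsumint, rieszEnergy, Finset.mul_sum]
    refine Finset.sum_le_sum fun y hy => ?_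
    rw [integral_finsetSum _ (hpair y hy), Finset.mul_sum]
    refine Finset.sum_le_sum fun x hx => ?_
    have hr := norm_sub_pos_of_mem_filter hx
    have h := integral_gamma_kernel ha0 hr
    rw [show 2 * a = d by rw [ha]; ring] at h
    rw [← h]
    refine setIntegral_mono_set (integrableOn_gamma_kernel ha0 hr) ?_ hsub.eventuallyLE
    refine (ae_restrict_iff' measurableSet_Ioi).2 (ae_of_all _ fun t ht => ?_)
    have ht : 0 < t := ht
    show 0 ≤ t ^ (a - 1) * Real.exp (-t * ‖x - y‖ ^ 2)
    positivity
  -- By positivity, cutting the range of t down to (T, R] only lowers the energy side; what remains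
  -- is to integrate the pointwise Gaussian bound.
  refine le_trans ?_ hup
  have hi1 : IntervalIntegrable (fun t : ℝ => t⁻¹) volume T R :=
    intervalIntegrable_inv_iff.2 (Or.inr fun h => by
      rw [Set.uIcc_of_le hN] at h; linarith [h.1])
  have hi2 : IntervalIntegrable (fun t : ℝ => t ^ (a - 1)) volume T R :=
    intervalIntegral.intervalIntegrable_rpow' (by linarith)
  have hint : ∫ t in T..R, ((1 - η) * Real.pi ^ a * N ^ 2 * t⁻¹ - N * t ^ (a - 1)) =
      (1 - η) * Real.pi ^ a * N ^ 2 * (2 / d * Real.log N - Real.log T) -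
        N * ((N - T ^ a) / a) := by
    rw [intervalIntegral.integral_sub (hi1.const_mul _) (hi2.const_mul _),
      intervalIntegral.integral_const_mul, intervalIntegral.integral_const_mul,
      integral_inv_of_pos hT hR0, integral_rpow (Or.inl (by linarith)), sub_add_cancel, hRa,
      Real.log_div hR0.ne' hT.ne', hlogR]
  have hTa : 0 ≤ T ^ a := by positivity
  calc _ ≤ ∫ t in T..R, ((1 - η) * Real.pi ^ a * N ^ 2 * t⁻¹ - N * t ^ (a - 1)) := by
        rw [hint]
        have : N * ((N - T ^ a) / a) ≤ 2 / d * N ^ 2 := by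
          have h2 : 2 / (d : ℝ) * N ^ 2 = N * (N / a) := by rw [ha]; field_simp
          rw [h2]
          gcongr
          linarith
        linarith
    _ ≤ _ := by
        rw [intervalIntegral.integral_of_le hN]
        refine setIntegral_mono_on ?_ (integrable_finsetSum _ hsumint) measurableSet_Ioc
          fun t ht => ?_
        · exact ((hi1.const_mul _).sub (hi2.const_mul _)).1
        · have ht0 : 0 < t := hsub ht
          have h := hgauss t ht.1.le ω hω
          rw [sum_gaussian_eq_card_add] at h
          have h' := mul_le_mul_of_nonneg_left h (show 0 ≤ t ^ (a - 1) by positivity)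
          have hta : t ^ (a - 1) * (Real.pi / t) ^ a = Real.pi ^ a * t⁻¹ := by
            rw [Real.div_rpow hpi.le ht0.le, Real.rpow_sub_one ht0.ne']
            field_simp
          simp only [← Finset.mul_sum]
          have h3 : t ^ (a - 1) * ((1 - η) * ((Real.pi / t) ^ a * N ^ 2)) =
              (1 - η) * Real.pi ^ a * N ^ 2 * t⁻¹ := by
            linear_combination ((1 - η) * N ^ 2) * hta
          rw [h3] at h'
          linarith

/-- The value t = π(N/4)^(2/d) makes the Gaussian lower bound equal to 2N, twice the diagonal, so
the off-diagonal sum is at least N. Each off-diagonal Gaussian is then dominated by a multiple of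
t^(-s/2)|x-y|^(-s). -/
theorem rieszEnergy_supercritical_ge (hd : 1 ≤ d) {s T : ℝ} (hs : 0 < s)
    (hgauss : ∀ t, T ≤ t → ∀ ω : Finset (EuclideanSpace ℝ (Fin d)),
      (ω : Set _) ⊆ unitCube d →
        (1 - 1 / 2) * ((Real.pi / t) ^ ((d : ℝ) / 2) * (ω.card : ℝ) ^ 2) ≤
          ∑ x ∈ ω, ∑ y ∈ ω, Real.exp (-t * ‖x - y‖ ^ 2))
    (ω : Finset (EuclideanSpace ℝ (Fin d))) (hω : (ω : Set _) ⊆ unitCube d)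
    (hN : T ≤ Real.pi * ((ω.card : ℝ) / 4) ^ (2 / (d : ℝ))) (hN0 : 0 < ω.card) :
    (Real.pi ^ (s / 2) / (4 ^ (s / d) * (s / 2) ^ (s / 2))) * (ω.card : ℝ) ^ (1 + s / d) ≤
      rieszEnergy s ω := by
  have hpi := Real.pi_pos
  have hd0 : (0 : ℝ) < d := by exact_mod_cast hd
  have hN0' : (0 : ℝ) < ω.card := by exact_mod_cast hN0
  set N : ℝ := (ω.card : ℝ) with hNdef
  set t : ℝ := Real.pi * (N / 4) ^ (2 / (d : ℝ)) with ht
  have ht0 : 0 < t := by positivity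
  have h := hgauss t hN ω hω
  have htd : (Real.pi / t) ^ ((d : ℝ) / 2) = 4 / N := by
    have h1 : Real.pi / t = (4 / N) ^ (2 / (d : ℝ)) := by
      rw [ht, ← inv_div N 4, Real.inv_rpow (by positivity)]
      field_simp
    rw [h1, ← Real.rpow_mul (by positivity)]
    have : 2 / (d : ℝ) * (d / 2) = 1 := by field_simp
    rw [this, Real.rpow_one]
  rw [htd, sum_gaussian_eq_card_add] at h
  have h2 : (1 - 1 / 2) * (4 / N * N ^ 2) = 2 * N := by field_simp; norm_num
  rw [← hNdef, h2] at h
  have hoff : N ≤ ∑ y ∈ ω, ∑ x ∈ ω with x ≠ y, Real.exp (-t * ‖x - y‖ ^ 2) := by linarith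
  have hle : ∑ y ∈ ω, ∑ x ∈ ω with x ≠ y, Real.exp (-t * ‖x - y‖ ^ 2) ≤
      (s / 2) ^ (s / 2) / t ^ (s / 2) * rieszEnergy s ω := by
    rw [rieszEnergy, Finset.mul_sum]
    refine Finset.sum_le_sum fun y _ => ?_
    rw [Finset.mul_sum]
    refine Finset.sum_le_sum fun x hx => ?_
    have hr := norm_sub_pos_of_mem_filter hx
    have h := rpow_mul_exp_neg_le (show 0 < s / 2 by positivity)
      (show 0 < t * ‖x - y‖ ^ 2 by positivity)
    rw [neg_mul]
    refine h.trans_eq ?_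
    rw [Real.mul_rpow ht0.le (by positivity), ← Real.rpow_two, ← Real.rpow_mul hr.le,
      mul_div_cancel₀ s two_ne_zero]
    field_simp
  have hfin := hoff.trans hle
  have hts : t ^ (s / 2) = Real.pi ^ (s / 2) * (N ^ (s / d) / 4 ^ (s / d)) := by
    rw [ht, Real.mul_rpow hpi.le (by positivity), ← Real.rpow_mul (by positivity),
      Real.div_rpow hN0'.le (by norm_num)]
    have : 2 / (d : ℝ) * (s / 2) = s / d := by field_simp
    rw [this]
  have hts0 : 0 < t ^ (s / 2) := by positivity
  rw [div_mul_eq_mul_div, le_div_iff₀ hts0, hts] at hfin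
  rw [Real.rpow_add hN0', Real.rpow_one, div_mul_eq_mul_div, div_le_iff₀ (by positivity)]
  have h4 : (0 : ℝ) < 4 ^ (s / d) := by positivity
  have := mul_le_mul_of_nonneg_right hfin h4.le
  calc _ = N * (Real.pi ^ (s / 2) * (N ^ (s / d) / 4 ^ (s / d))) * 4 ^ (s / d) := by field_simp
    _ ≤ _ := this
    _ = _ := by ring

end EnergyLowerBounds

/-! ### Truncated Epstein zeta sums of the integer lattice. -/

section LatticeSums

/-- The integer point `k` seen in `ℝ^d`. -/
noncomputable def latticePoint {d : ℕ} (k : Fin d → ℤ) : EuclideanSpace ℝ (Fin d) :=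
  WithLp.toLp 2 fun i => (k i : ℝ)

/-- The integer points of `[-n, n]^d`. -/
noncomputable def latticeBox (d n : ℕ) : Finset (Fin d → ℤ) :=
  Fintype.piFinset fun _ => Finset.Icc (-(n : ℤ)) n

/-- The truncated Epstein zeta sum of the integer lattice. -/
noncomputable def latticeSum (d : ℕ) (s : ℝ) (n : ℕ) : ℝ :=
  ∑ k ∈ latticeBox d n with k ≠ 0, 1 / ‖latticePoint k‖ ^ s

variable {d : ℕ}

theorem latticePoint_apply (k : Fin d → ℤ) (i : Fin d) : latticePoint k i = (k i : ℝ) := rfl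

theorem norm_sq_latticePoint (k : Fin d → ℤ) : ‖latticePoint k‖ ^ 2 = ∑ i, (k i : ℝ) ^ 2 := by
  rw [EuclideanSpace.norm_sq_eq]
  simp [latticePoint_apply]

theorem one_le_norm_latticePoint {k : Fin d → ℤ} (hk : k ≠ 0) : 1 ≤ ‖latticePoint k‖ := by
  obtain ⟨i, hi⟩ := Function.ne_iff.1 hk
  refine le_trans ?_ (PiLp.norm_apply_le (latticePoint k) i)
  rw [latticePoint_apply, Real.norm_eq_abs, ← Int.cast_abs]
  exact_mod_cast Int.one_le_abs hi

theorem latticeSum_nonneg (d : ℕ) (s : ℝ) (n : ℕ) : 0 ≤ latticeSum d s n :=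
  Finset.sum_nonneg fun _ _ => by positivity

theorem summable_int_one_add_abs_rpow {p : ℝ} (hp : 1 < p) :
    Summable fun j : ℤ => 1 / (1 + |(j : ℝ)|) ^ p := by
  have h : Summable fun n : ℕ => 1 / (1 + |(n : ℝ)|) ^ p := by
    refine ((Real.summable_one_div_nat_add_rpow 1 p).2 hp).congr fun n => ?_
    rw [abs_of_nonneg (by positivity : (0 : ℝ) ≤ (n : ℝ) + 1), Nat.abs_cast, add_comm]
  refine Summable.of_nat_of_neg ?_ ?_
  · simpa using h
  · simpa using h

/-- Every factor satisfies 1 + |k_i| ≤ 2‖k‖. The product form lets the lattice sum factor into d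
one-dimensional series, which converge when s/d > 1. -/
theorem one_div_norm_latticePoint_rpow_le (hd : 1 ≤ d) {s : ℝ} (hs : 0 < s) {k : Fin d → ℤ}
    (hk : k ≠ 0) :
    1 / ‖latticePoint k‖ ^ s ≤ 2 ^ s * ∏ i, 1 / (1 + |(k i : ℝ)|) ^ (s / d) := by
  have hd0 : (0 : ℝ) < d := by exact_mod_cast hd
  have h1 := one_le_norm_latticePoint hk
  have h0 : 0 < ‖latticePoint k‖ := one_pos.trans_le h1
  have hprod : ∏ i, (1 + |(k i : ℝ)|) ^ (s / d) ≤ 2 ^ s * ‖latticePoint k‖ ^ s := by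
    calc ∏ i, (1 + |(k i : ℝ)|) ^ (s / d) ≤ ∏ _i : Fin d, (2 * ‖latticePoint k‖) ^ (s / d) := by
          refine Finset.prod_le_prod (fun i _ => by positivity) fun i _ => ?_
          have : |(k i : ℝ)| ≤ ‖latticePoint k‖ := PiLp.norm_apply_le (latticePoint k) i
          gcongr
          linarith
      _ = 2 ^ s * ‖latticePoint k‖ ^ s := by
          rw [Finset.prod_const, Finset.card_univ, Fintype.card_fin, ← Real.rpow_natCast,
            ← Real.rpow_mul (by positivity), div_mul_cancel₀ _ hd0.ne',
            Real.mul_rpow (by norm_num) h0.le]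
  have hpos : 0 < ∏ i, (1 + |(k i : ℝ)|) ^ (s / d) := Finset.prod_pos fun i _ => by positivity
  simp only [one_div, Finset.prod_inv_distrib]
  rw [← div_eq_mul_inv, le_div_iff₀ hpos, inv_mul_le_iff₀ (by positivity), mul_comm]
  exact hprod

theorem exists_latticeSum_le (hd : 1 ≤ d) {s : ℝ} (hs : (d : ℝ) < s) :
    ∃ C : ℝ, ∀ n, latticeSum d s n ≤ C := by
  have hd0 : (0 : ℝ) < d := by exact_mod_cast hd
  have hsum := summable_int_one_add_abs_rpow ((one_lt_div hd0).2 hs)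
  refine ⟨2 ^ s * (∑' j : ℤ, 1 / (1 + |(j : ℝ)|) ^ (s / d)) ^ d, fun n => ?_⟩
  calc latticeSum d s n
      ≤ ∑ k ∈ latticeBox d n with k ≠ 0, 2 ^ s * ∏ i, 1 / (1 + |(k i : ℝ)|) ^ (s / d) :=
        Finset.sum_le_sum fun k hk =>
          one_div_norm_latticePoint_rpow_le hd (hd0.trans hs) (Finset.mem_filter.1 hk).2
    _ ≤ ∑ k ∈ latticeBox d n, 2 ^ s * ∏ i, 1 / (1 + |(k i : ℝ)|) ^ (s / d) :=
        Finset.sum_le_sum_of_subset_of_nonneg (Finset.filter_subset _ _) fun k _ _ => by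
          have : 0 ≤ ∏ i, 1 / (1 + |(k i : ℝ)|) ^ (s / d) :=
            Finset.prod_nonneg fun i _ => by positivity
          positivity
    _ = 2 ^ s * (∑ j ∈ Finset.Icc (-(n : ℤ)) n, 1 / (1 + |(j : ℝ)|) ^ (s / d)) ^ d := by
        rw [← Finset.mul_sum, latticeBox, ← Finset.prod_univ_sum (fun _ => Finset.Icc (-(n : ℤ)) n)
          (fun _ j => 1 / (1 + |(j : ℝ)|) ^ (s / d))]
        simp
    _ ≤ _ := by
        gcongr
        exact hsum.sum_le_tsum _ fun j _ => by positivity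

theorem sum_Icc_neg_eq (f : ℤ → ℝ) (n : ℕ) :
    ∑ j ∈ Finset.Icc (-(n : ℤ)) n, f j =
      f 0 + ∑ i ∈ Finset.range n, (f ((i + 1 : ℕ) : ℤ) + f (-((i + 1 : ℕ) : ℤ))) := by
  induction n with
  | zero => simp
  | succ n ih =>
    have : Finset.Icc (-((n + 1 : ℕ) : ℤ)) ((n + 1 : ℕ) : ℤ) =
        insert ((n + 1 : ℕ) : ℤ) (insert (-((n + 1 : ℕ) : ℤ)) (Finset.Icc (-(n : ℤ)) n)) := by
      ext j
      simp only [Finset.mem_Icc, Finset.mem_insert]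
      omega
    rw [this, Finset.sum_insert, Finset.sum_insert, ih, Finset.sum_range_succ]
    · ring
    · simp
    · simp only [Finset.mem_insert, Finset.mem_Icc]
      omega

/-- A truncated theta series is bounded by one plus the corresponding Gaussian integral. -/
theorem sum_Icc_exp_neg_le {t : ℝ} (ht : 0 < t) (n : ℕ) :
    ∑ j ∈ Finset.Icc (-(n : ℤ)) n, Real.exp (-t * (j : ℝ) ^ 2) ≤ 1 + √(Real.pi / t) := by
  rw [sum_Icc_neg_eq (fun j => Real.exp (-t * (j : ℝ) ^ 2))]
  have hint := integrable_exp_neg_mul_sq ht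
  have hanti : AntitoneOn (fun x : ℝ => Real.exp (-t * x ^ 2)) (Set.Icc 0 (0 + (n : ℕ))) := by
    intro x hx y _ hxy
    simp only [Real.exp_le_exp]
    have : x ^ 2 ≤ y ^ 2 := pow_le_pow_left₀ hx.1 hxy 2
    nlinarith
  have h := hanti.sum_le_integral
  simp only [zero_add] at h
  have h2 : ∫ x in (0 : ℝ)..n, Real.exp (-t * x ^ 2) ≤ √(Real.pi / t) / 2 := by
    rw [← integral_gaussian_Ioi, intervalIntegral.integral_of_le (by positivity)]
    exact setIntegral_mono_set hint.integrableOn (ae_of_all _ fun x => (Real.exp_pos _).le)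
      Set.Ioc_subset_Ioi_self.eventuallyLE
  have h3 : ∀ i : ℕ, Real.exp (-t * (((i + 1 : ℕ) : ℤ) : ℝ) ^ 2) +
      Real.exp (-t * ((-((i + 1 : ℕ) : ℤ) : ℤ) : ℝ) ^ 2) =
      2 * Real.exp (-t * ((i + 1 : ℕ) : ℝ) ^ 2) := by
    intro i
    push_cast
    rw [neg_sq]
    ring
  simp only [h3, ← Finset.mul_sum]
  simp only [Int.cast_zero, ne_eq, OfNat.ofNat_ne_zero, not_false_eq_true, zero_pow, mul_zero,
    Real.exp_zero]
  linarith

/-- The Gaussian sum over the nonzero points of `latticeBox d n`. -/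
noncomputable def latticeGauss (d n : ℕ) (t : ℝ) : ℝ :=
  ∑ k ∈ latticeBox d n with k ≠ 0, Real.exp (-t * ‖latticePoint k‖ ^ 2)

/-- The first of three bounds for three ranges of t: this one for t ≤ n⁻², where the truncation
matters, the theta bound for n⁻² < t ≤ 1, and exponential decay for t > 1. -/
theorem latticeGauss_le_card (n : ℕ) {t : ℝ} (ht : 0 < t) :
    latticeGauss d n t ≤ (2 * n + 1) ^ d := by
  calc latticeGauss d n t ≤ ∑ k ∈ latticeBox d n with k ≠ 0, (1 : ℝ) :=
        Finset.sum_le_sum fun k _ => Real.exp_le_one_iff.2 (by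
          have : 0 ≤ t * ‖latticePoint k‖ ^ 2 := by positivity
          linarith)
    _ ≤ ∑ k ∈ latticeBox d n, (1 : ℝ) :=
        Finset.sum_le_sum_of_subset_of_nonneg (Finset.filter_subset _ _) fun _ _ _ => zero_le_one
    _ = (2 * n + 1) ^ d := by
        simp only [Finset.sum_const, nsmul_eq_mul, mul_one, latticeBox, Fintype.card_piFinset,
          Finset.prod_const, Finset.card_univ, Fintype.card_fin, Int.card_Icc]
        rw [show ((n : ℤ) + 1 - -(n : ℤ)).toNat = 2 * n + 1 by omega]
        push_cast
        rfl

theorem latticeGauss_le_theta (n : ℕ) {t : ℝ} (ht : 0 < t) :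
    latticeGauss d n t ≤ (1 + √(Real.pi / t)) ^ d := by
  calc latticeGauss d n t ≤ ∑ k ∈ latticeBox d n, Real.exp (-t * ‖latticePoint k‖ ^ 2) :=
        Finset.sum_le_sum_of_subset_of_nonneg (Finset.filter_subset _ _)
          fun _ _ _ => (Real.exp_pos _).le
    _ = (∑ j ∈ Finset.Icc (-(n : ℤ)) n, Real.exp (-t * (j : ℝ) ^ 2)) ^ d := by
        simp only [norm_sq_latticePoint, Finset.mul_sum, Real.exp_sum]
        rw [latticeBox, ← Finset.prod_univ_sum (fun _ => Finset.Icc (-(n : ℤ)) n)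
          (fun _ j => Real.exp (-t * (j : ℝ) ^ 2))]
        simp
    _ ≤ _ := by
        gcongr
        exact sum_Icc_exp_neg_le ht n

/-- Nonzero lattice points have norm at least 1, so passing from parameter 1 to t gains a factor
exp(1 - t) in every term. -/
theorem latticeGauss_le_exp (n : ℕ) {t : ℝ} (ht : 1 ≤ t) :
    latticeGauss d n t ≤ (1 + √Real.pi) ^ d * Real.exp 1 * Real.exp (-t) := by
  have h1 := latticeGauss_le_theta (d := d) n one_pos
  rw [div_one] at h1
  have h2 : latticeGauss d n t ≤ Real.exp (1 - t) * latticeGauss d n 1 := by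
    rw [latticeGauss, latticeGauss, Finset.mul_sum]
    refine Finset.sum_le_sum fun k hk => ?_
    rw [← Real.exp_add, Real.exp_le_exp]
    have := one_le_norm_latticePoint (Finset.mem_filter.1 hk).2
    have : 1 ≤ ‖latticePoint k‖ ^ 2 := one_le_pow₀ this
    nlinarith
  refine h2.trans ?_
  rw [Real.exp_sub, div_eq_mul_inv, ← Real.exp_neg]
  have := mul_le_mul_of_nonneg_left h1 (mul_pos (Real.exp_pos 1) (Real.exp_pos (-t))).le
  linarith

/-- Convexity of the power on the chord from p to p + 1. It splits (√π + √t)^d into the constant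
responsible for the logarithm and an error O(√t), integrable against dt/t near 0. -/
theorem add_pow_le_of_le_one {p u : ℝ} (hp : 0 ≤ p) (hu : 0 ≤ u) (hu' : u ≤ 1) (n : ℕ) :
    (p + u) ^ n ≤ p ^ n + (p + 1) ^ n * u := by
  have h := (convexOn_pow n).2 (show p ∈ Set.Ici (0 : ℝ) from hp)
    (show p + 1 ∈ Set.Ici (0 : ℝ) by simp; linarith) (sub_nonneg.2 hu') hu (by ring)
  simp only [smul_eq_mul] at h
  rw [show (1 - u) * p + u * (p + 1) = p + u by ring] at h
  have : 0 ≤ u * p ^ n := by positivity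
  linarith

theorem integral_latticeGauss (hd : 1 ≤ d) (n : ℕ) :
    IntegrableOn (fun t : ℝ => t ^ ((d : ℝ) / 2 - 1) * latticeGauss d n t) (Set.Ioi 0) ∧
    ∫ t in Set.Ioi (0 : ℝ), t ^ ((d : ℝ) / 2 - 1) * latticeGauss d n t =
      Real.Gamma ((d : ℝ) / 2) * latticeSum d d n := by
  have hd0 : (0 : ℝ) < d := by exact_mod_cast hd
  have hpos : ∀ k ∈ (latticeBox d n).filter (fun k => k ≠ 0), 0 < ‖latticePoint k‖ :=
    fun k hk => one_pos.trans_le (one_le_norm_latticePoint (Finset.mem_filter.1 hk).2)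
  have hint := fun k hk => integrableOn_gamma_kernel (show 0 < (d : ℝ) / 2 by positivity)
    (hpos k hk)
  simp only [latticeGauss, Finset.mul_sum, latticeSum]
  refine ⟨integrable_finsetSum _ hint, ?_⟩
  rw [integral_finsetSum _ hint]
  refine Finset.sum_congr rfl fun k hk => ?_
  rw [integral_gamma_kernel (by positivity) (hpos k hk), mul_div_cancel₀ _ (two_ne_zero)]

theorem setIntegral_latticeGauss_Ioc_le (hd : 1 ≤ d) {n : ℕ} (hn : 1 ≤ n) :
    ∫ t in Set.Ioc (0 : ℝ) ((n : ℝ) ^ 2)⁻¹, t ^ ((d : ℝ) / 2 - 1) * latticeGauss d n t ≤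
      3 ^ d * (2 / d) := by
  have hd0 : (0 : ℝ) < d := by exact_mod_cast hd
  have hn0 : (1 : ℝ) ≤ n := by exact_mod_cast hn
  have hn1 : (0 : ℝ) < n := by linarith
  set ε : ℝ := ((n : ℝ) ^ 2)⁻¹ with hε
  have hε0 : 0 < ε := by positivity
  have hi : IntervalIntegrable (fun t : ℝ => t ^ ((d : ℝ) / 2 - 1)) volume 0 ε :=
    intervalIntegral.intervalIntegrable_rpow' (by linarith [show 0 < (d : ℝ) / 2 by positivity])
  calc _ ≤ ∫ t in Set.Ioc (0 : ℝ) ε, t ^ ((d : ℝ) / 2 - 1) * (2 * n + 1) ^ d := by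
        refine setIntegral_mono_on ((integral_latticeGauss hd n).1.mono_set
          Set.Ioc_subset_Ioi_self) (hi.mul_const _).1 measurableSet_Ioc fun t ht => ?_
        have ht0 : 0 < t := ht.1
        exact mul_le_mul_of_nonneg_left (latticeGauss_le_card n ht0) (by positivity)
    _ = (2 * n + 1) ^ d * (ε ^ ((d : ℝ) / 2) / ((d : ℝ) / 2)) := by
        rw [← intervalIntegral.integral_of_le hε0.le, intervalIntegral.integral_mul_const,
          integral_rpow (Or.inl (by linarith [show 0 < (d : ℝ) / 2 by positivity])),
          sub_add_cancel, Real.zero_rpow (by positivity), sub_zero, mul_comm]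
    -- The cutoff ε = n⁻² makes ε^(d/2) = n^(-d), which cancels the number of lattice points up to a
    -- constant.
    _ ≤ (3 * n) ^ d * (ε ^ ((d : ℝ) / 2) / ((d : ℝ) / 2)) := by
        gcongr
        linarith
    _ = _ := by
        have : ε ^ ((d : ℝ) / 2) = ((n : ℝ) ^ d)⁻¹ := by
          rw [hε, Real.inv_rpow (by positivity), ← Real.rpow_natCast, ← Real.rpow_mul hn1.le]
          push_cast
          rw [mul_div_cancel₀ _ (two_ne_zero), Real.rpow_natCast]
        rw [this, mul_pow]
        field_simp

theorem setIntegral_latticeGauss_Ioc_one_le (hd : 1 ≤ d) {n : ℕ} (hn : 1 ≤ n) :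
    ∫ t in Set.Ioc ((n : ℝ) ^ 2)⁻¹ 1, t ^ ((d : ℝ) / 2 - 1) * latticeGauss d n t ≤
      Real.pi ^ ((d : ℝ) / 2) * (2 * Real.log n) + (√Real.pi + 1) ^ d * 2 := by
  have hpi := Real.pi_pos
  have hd0 : (0 : ℝ) < d := by exact_mod_cast hd
  have hn0 : (1 : ℝ) ≤ n := by exact_mod_cast hn
  have hn1 : (0 : ℝ) < n := by linarith
  set ε : ℝ := ((n : ℝ) ^ 2)⁻¹ with hε
  have hε0 : 0 < ε := by positivity
  have hε1 : ε ≤ 1 := inv_le_one_of_one_le₀ (one_le_pow₀ hn0)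
  have hi1 : IntervalIntegrable (fun t : ℝ => t⁻¹) volume ε 1 :=
    intervalIntegrable_inv_iff.2 (Or.inr fun h => by
      rw [Set.uIcc_of_le hε1] at h; linarith [h.1])
  have hi2 : IntervalIntegrable (fun t : ℝ => t ^ (-(1 / 2) : ℝ)) volume ε 1 :=
    intervalIntegral.intervalIntegrable_rpow' (by norm_num)
  have hsub : Set.Ioc ε 1 ⊆ Set.Ioi 0 := fun t ht => hε0.trans ht.1
  calc _ ≤ ∫ t in Set.Ioc ε 1, (Real.pi ^ ((d : ℝ) / 2) * t⁻¹ +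
          (√Real.pi + 1) ^ d * t ^ (-(1 / 2) : ℝ)) := by
        refine setIntegral_mono_on ((integral_latticeGauss hd n).1.mono_set hsub)
          ((hi1.const_mul _).add (hi2.const_mul _)).1 measurableSet_Ioc fun t ht => ?_
        have ht0 : 0 < t := hsub ht
        have hst : 0 < √t := Real.sqrt_pos.2 ht0
        have hsq : √t ^ 2 = t := Real.sq_sqrt ht0.le
        have hst1 : √t ≤ 1 := Real.sqrt_le_one.2 ht.2
        have htd : t ^ ((d : ℝ) / 2 - 1) = √t ^ d * t⁻¹ := by
          rw [Real.rpow_sub_one ht0.ne', Real.sqrt_eq_rpow, ← Real.rpow_natCast,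
            ← Real.rpow_mul ht0.le, div_eq_mul_inv]
          congr 2
          ring
        have hpd : Real.pi ^ ((d : ℝ) / 2) = √Real.pi ^ d := by
          rw [Real.sqrt_eq_rpow, ← Real.rpow_natCast, ← Real.rpow_mul hpi.le]
          congr 1
          ring
        have hth : t ^ (-(1 / 2) : ℝ) = √t * t⁻¹ := by
          rw [Real.rpow_neg ht0.le, ← Real.sqrt_eq_rpow]
          rw [← div_eq_mul_inv, eq_div_iff ht0.ne']
          nth_rewrite 2 [← hsq]
          field_simp
        calc t ^ ((d : ℝ) / 2 - 1) * latticeGauss d n t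
            ≤ t ^ ((d : ℝ) / 2 - 1) * (1 + √(Real.pi / t)) ^ d :=
              mul_le_mul_of_nonneg_left (latticeGauss_le_theta n ht0) (by positivity)
          _ = t⁻¹ * (√Real.pi + √t) ^ d := by
              rw [htd, Real.sqrt_div hpi.le, mul_right_comm, ← mul_pow, mul_comm t⁻¹]
              congr 2
              field_simp
              ring
          _ ≤ t⁻¹ * (√Real.pi ^ d + (√Real.pi + 1) ^ d * √t) := by
              gcongr
              exact add_pow_le_of_le_one (Real.sqrt_nonneg _) hst.le hst1 d
          _ = _ := by rw [hpd, hth]; ring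
    _ ≤ _ := by
        rw [← intervalIntegral.integral_of_le hε1, intervalIntegral.integral_add
          (hi1.const_mul _) (hi2.const_mul _), intervalIntegral.integral_const_mul,
          intervalIntegral.integral_const_mul, integral_inv_of_pos hε0 one_pos,
          integral_rpow (Or.inl (by norm_num))]
        have hlog : Real.log (1 / ε) = 2 * Real.log n := by
          rw [hε, one_div, inv_inv, Real.log_pow]
          norm_num
        rw [hlog]
        gcongr
        have : 0 ≤ ε ^ ((-(1 / 2) : ℝ) + 1) := by positivity
        rw [Real.one_rpow, div_le_iff₀ (by norm_num)]
        norm_num at this ⊢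
        linarith

theorem setIntegral_latticeGauss_Ioi_one_le (hd : 1 ≤ d) (n : ℕ) :
    ∫ t in Set.Ioi (1 : ℝ), t ^ ((d : ℝ) / 2 - 1) * latticeGauss d n t ≤
      (1 + √Real.pi) ^ d * Real.exp 1 * Real.Gamma ((d : ℝ) / 2) := by
  have hd0 : (0 : ℝ) < d := by exact_mod_cast hd
  have ha : 0 < (d : ℝ) / 2 := by positivity
  set c : ℝ := (1 + √Real.pi) ^ d * Real.exp 1
  have hc : 0 ≤ c := by positivity
  have hsub : Set.Ioi (1 : ℝ) ⊆ Set.Ioi 0 := Set.Ioi_subset_Ioi zero_le_one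
  have hi : IntegrableOn (fun t => c * (Real.exp (-t) * t ^ ((d : ℝ) / 2 - 1))) (Set.Ioi 0) :=
    (Real.GammaIntegral_convergent ha).const_mul c
  rw [Real.Gamma_eq_integral ha, ← integral_const_mul]
  calc _ ≤ ∫ t in Set.Ioi (1 : ℝ), c * (Real.exp (-t) * t ^ ((d : ℝ) / 2 - 1)) := by
        refine setIntegral_mono_on ((integral_latticeGauss hd n).1.mono_set hsub)
          (hi.mono_set hsub) measurableSet_Ioi fun t ht => ?_
        have ht1 : 1 < t := ht
        have := mul_le_mul_of_nonneg_left (latticeGauss_le_exp (d := d) n ht1.le)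
          (show 0 ≤ t ^ ((d : ℝ) / 2 - 1) by positivity)
        linarith
    _ ≤ _ := by
        refine setIntegral_mono_set hi ?_ hsub.eventuallyLE
        refine (ae_restrict_iff' measurableSet_Ioi).2 (ae_of_all _ fun t ht => ?_)
        have ht : 0 < t := ht
        show 0 ≤ c * (Real.exp (-t) * t ^ ((d : ℝ) / 2 - 1))
        positivity

/-- Split the Gamma integral at n⁻² and 1. Only the middle range grows: there ∫ dt/t = 2 log n with
coefficient π^(d/2), and the outer ranges are O(1). -/
theorem exists_latticeSum_critical_le (hd : 1 ≤ d) :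
    ∃ C : ℝ, ∀ n : ℕ, 1 ≤ n → latticeSum d d n ≤
      2 * Real.pi ^ ((d : ℝ) / 2) / Real.Gamma ((d : ℝ) / 2) * Real.log n + C := by
  have hd0 : (0 : ℝ) < d := by exact_mod_cast hd
  have hG : 0 < Real.Gamma ((d : ℝ) / 2) := Real.Gamma_pos_of_pos (by positivity)
  refine ⟨(3 ^ d * (2 / d) + (√Real.pi + 1) ^ d * 2 +
    (1 + √Real.pi) ^ d * Real.exp 1 * Real.Gamma ((d : ℝ) / 2)) / Real.Gamma ((d : ℝ) / 2),
    fun n hn => ?_⟩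
  have hn0 : (1 : ℝ) ≤ n := by exact_mod_cast hn
  have hε0 : (0 : ℝ) < ((n : ℝ) ^ 2)⁻¹ := by positivity
  have hε1 : ((n : ℝ) ^ 2)⁻¹ ≤ 1 := inv_le_one_of_one_le₀ (one_le_pow₀ hn0)
  obtain ⟨hi, he⟩ := integral_latticeGauss hd n
  have h1 := setIntegral_latticeGauss_Ioc_le hd hn
  have h2 := setIntegral_latticeGauss_Ioc_one_le hd hn
  have h3 := setIntegral_latticeGauss_Ioi_one_le hd n
  rw [← Set.Ioc_union_Ioi_eq_Ioi hε0.le, setIntegral_union (Set.Ioc_disjoint_Ioi le_rfl)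
    measurableSet_Ioi (hi.mono_set Set.Ioc_subset_Ioi_self)
    (hi.mono_set (Set.Ioi_subset_Ioi hε0.le)), ← Set.Ioc_union_Ioi_eq_Ioi hε1,
    setIntegral_union (Set.Ioc_disjoint_Ioi le_rfl)
    measurableSet_Ioi (hi.mono_set fun t ht => hε0.trans ht.1)
    (hi.mono_set (Set.Ioi_subset_Ioi zero_le_one))] at he
  rw [div_mul_eq_mul_div, ← add_div, le_div_iff₀ hG]
  linarith

end LatticeSums

/-! ### Shrunk copies of a configuration in the cells of the cube. -/

section ScaledCopies

variable {d : ℕ}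

/-- The lower left corners of the `m ^ d` cells of side one in `[0, m]^d`. -/
noncomputable def cellCorners (d m : ℕ) : Finset (Fin d → ℤ) :=
  Fintype.piFinset fun _ => Finset.Ico (0 : ℤ) m

theorem card_cellCorners (d m : ℕ) : (cellCorners d m).card = m ^ d := by
  simp [cellCorners, Fintype.card_piFinset]

theorem sum_cellCorners_le_latticeSum (s : ℝ) (m : ℕ) (b : Fin d → ℤ)
    (hb : b ∈ cellCorners d m) :
    ∑ a ∈ cellCorners d m with a ≠ b, 1 / ‖latticePoint (a - b)‖ ^ s ≤ latticeSum d s m := by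
  classical
  have hinj : Set.InjOn (fun a : Fin d → ℤ => a - b)
      ((cellCorners d m).filter (fun a => a ≠ b)) := fun a _ a' _ h => sub_left_injective h
  rw [← Finset.sum_image (f := fun k => 1 / ‖latticePoint k‖ ^ s) hinj, latticeSum]
  refine Finset.sum_le_sum_of_subset_of_nonneg (fun k hk => ?_) fun _ _ _ => by positivity
  obtain ⟨a, ha, rfl⟩ := Finset.mem_image.1 hk
  obtain ⟨ha, hab⟩ := Finset.mem_filter.1 ha
  refine Finset.mem_filter.2 ⟨Fintype.mem_piFinset.2 fun i => ?_, sub_ne_zero.2 hab⟩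
  have h1 := Finset.mem_Ico.1 (Fintype.mem_piFinset.1 ha i)
  have h2 := Finset.mem_Ico.1 (Fintype.mem_piFinset.1 hb i)
  rw [Finset.mem_Icc, Pi.sub_apply]
  omega

/-- The copy of the point `u` of the unit cube, shrunk by the factor `γ / m`, in the cell with
corner `a / m`. -/
noncomputable def cellMap (m : ℕ) (γ : ℝ)
    (p : (Fin d → ℤ) × EuclideanSpace ℝ (Fin d)) : EuclideanSpace ℝ (Fin d) :=
  (m : ℝ)⁻¹ • (latticePoint p.1 + γ • p.2)

theorem cellMap_apply (m : ℕ) (γ : ℝ) (p : (Fin d → ℤ) × EuclideanSpace ℝ (Fin d)) (i : Fin d) :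
    cellMap m γ p i = (m : ℝ)⁻¹ * ((p.1 i : ℝ) + γ * p.2 i) := by
  simp [cellMap, latticePoint_apply]
  ring

theorem norm_le_norm_of_abs_le {v w : EuclideanSpace ℝ (Fin d)} (h : ∀ i, |v i| ≤ |w i|) :
    ‖v‖ ≤ ‖w‖ := by
  rw [EuclideanSpace.norm_eq, EuclideanSpace.norm_eq]
  refine Real.sqrt_le_sqrt (Finset.sum_le_sum fun i _ => ?_)
  exact pow_le_pow_left₀ (abs_nonneg _) (h i) 2

theorem cellMap_mem_unitCube {m : ℕ} (hm : 1 ≤ m) {γ : ℝ} (hγ : 0 ≤ γ) (hγ' : γ < 1)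
    {a : Fin d → ℤ} (ha : a ∈ cellCorners d m) {u : EuclideanSpace ℝ (Fin d)}
    (hu : u ∈ unitCube d) : cellMap m γ (a, u) ∈ unitCube d := by
  intro i
  have hm0 : (0 : ℝ) < m := by exact_mod_cast hm
  have h1 := Finset.mem_Ico.1 (Fintype.mem_piFinset.1 ha i)
  have h2 : (0 : ℝ) ≤ a i := by exact_mod_cast h1.1
  have h3 : (a i : ℝ) + 1 ≤ m := by exact_mod_cast h1.2
  obtain ⟨h4, h5⟩ := hu i
  rw [cellMap_apply]
  have h6 : 0 ≤ γ * u i := by positivity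
  have h7 : γ * u i ≤ 1 := by nlinarith
  refine ⟨by positivity, ?_⟩
  rw [inv_mul_le_iff₀ hm0]
  linarith

/-- Coordinatewise, a nonzero integer difference k_i has |k_i| ≥ 1, while the positions inside the
cells shift it by at most γ ≤ γ|k_i|; a fraction 1 - γ of it survives. -/
theorem norm_cellMap_sub_ge {m : ℕ} {γ : ℝ} (hγ : 0 ≤ γ) (hγ' : γ < 1)
    (a b : Fin d → ℤ) {u v : EuclideanSpace ℝ (Fin d)}
    (hu : u ∈ unitCube d) (hv : v ∈ unitCube d) :
    (1 - γ) / m * ‖latticePoint (a - b)‖ ≤ ‖cellMap m γ (a, u) - cellMap m γ (b, v)‖ := by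
  have h1γ : 0 < 1 - γ := by linarith
  have : (1 - γ) / m * ‖latticePoint (a - b)‖ =
      ‖((1 - γ) / (m : ℝ)) • latticePoint (a - b)‖ := by
    rw [norm_smul, Real.norm_of_nonneg (by positivity)]
  rw [this]
  refine norm_le_norm_of_abs_le fun i => ?_
  rw [PiLp.sub_apply, cellMap_apply, cellMap_apply, PiLp.smul_apply, latticePoint_apply,
    smul_eq_mul, ← mul_sub, abs_mul, abs_mul, abs_of_nonneg (by positivity : 0 ≤ (1 - γ) / (m : ℝ)),
    abs_of_nonneg (by positivity : 0 ≤ (m : ℝ)⁻¹), div_eq_inv_mul, mul_assoc]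
  refine mul_le_mul_of_nonneg_left ?_ (by positivity)
  rcases eq_or_ne (a i) (b i) with h | h
  · simp [h]
  · have h1 : (1 : ℝ) ≤ |((a - b) i : ℤ)| := by
      rw [Pi.sub_apply]
      exact_mod_cast Int.one_le_abs (sub_ne_zero.2 h)
    rw [Int.cast_abs] at h1
    obtain ⟨hu0, hu1⟩ := hu i
    obtain ⟨hv0, hv1⟩ := hv i
    have h2 : |γ * (v i - u i)| ≤ γ := by
      rw [abs_mul, abs_of_nonneg hγ]
      exact mul_le_of_le_one_right hγ (abs_le.2 ⟨by linarith, by linarith⟩)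
    have h3 : (((a - b) i : ℤ) : ℝ) = (a i + γ * u i - (b i + γ * v i)) + γ * (v i - u i) := by
      rw [Pi.sub_apply]
      push_cast
      ring
    have h4 := abs_add_le (a i + γ * u i - (b i + γ * v i)) (γ * (v i - u i))
    rw [← h3] at h4
    simp only at h4 ⊢
    nlinarith

theorem norm_cellMap_sub_same (m : ℕ) {γ : ℝ} (hγ : 0 ≤ γ) (a : Fin d → ℤ)
    (u v : EuclideanSpace ℝ (Fin d)) :
    ‖cellMap m γ (a, u) - cellMap m γ (a, v)‖ = γ / m * ‖u - v‖ := by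
  have : cellMap m γ (a, u) - cellMap m γ (a, v) = (γ / m) • (u - v) := by
    simp only [cellMap]
    rw [← smul_sub, add_sub_add_left_eq_sub, ← smul_sub, smul_smul, div_eq_inv_mul]
  rw [this, norm_smul, Real.norm_of_nonneg (by positivity)]

/-- Injectivity of the scaling on ω is assumed in place of γ ≠ 0, so that γ = 0 remains available
for a single point. -/
theorem injOn_cellMap {m : ℕ} (hm : 1 ≤ m) {γ : ℝ} (hγ : 0 ≤ γ) (hγ' : γ < 1)
    {ω : Finset (EuclideanSpace ℝ (Fin d))} (hω : (ω : Set _) ⊆ unitCube d)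
    (hinj : Set.InjOn (fun u : EuclideanSpace ℝ (Fin d) => γ • u) ω) :
    Set.InjOn (cellMap (d := d) m γ) ↑(cellCorners d m ×ˢ ω) := by
  have hm0 : (0 : ℝ) < m := by exact_mod_cast hm
  rintro ⟨a, u⟩ hp ⟨b, v⟩ hq h
  have hp := Finset.mem_product.1 (Finset.mem_coe.1 hp)
  have hq := Finset.mem_product.1 (Finset.mem_coe.1 hq)
  have hab : a = b := by
    by_contra hab
    have h1 := norm_cellMap_sub_ge (m := m) hγ hγ' a b (hω hp.2) (hω hq.2)
    rw [h, sub_self, norm_zero] at h1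
    have h2 := one_le_norm_latticePoint (sub_ne_zero.2 hab)
    have h3 : 0 < (1 - γ) / m := div_pos (by linarith) hm0
    have : 0 < (1 - γ) / m * ‖latticePoint (a - b)‖ := mul_pos h3 (by linarith)
    linarith
  subst hab
  have huv : γ • u = γ • v :=
    add_left_cancel (smul_right_injective _ (inv_ne_zero hm0.ne') h)
  exact congrArg (Prod.mk a) (hinj hp.2 hq.2 huv)

theorem rieszEnergy_image {ι : Type*} [DecidableEq ι] (s : ℝ) {Φ : ι → EuclideanSpace ℝ (Fin d)}
    {P : Finset ι} (hΦ : Set.InjOn Φ P) [DecidableEq (EuclideanSpace ℝ (Fin d))] :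
    rieszEnergy s (P.image Φ) =
      ∑ q ∈ P, ∑ p ∈ P, if p ≠ q then 1 / ‖Φ p - Φ q‖ ^ s else 0 := by
  rw [rieszEnergy, Finset.sum_image hΦ]
  refine Finset.sum_congr rfl fun q hq => ?_
  rw [Finset.sum_filter, Finset.sum_image hΦ]
  refine Finset.sum_congr rfl fun p hp => ?_
  by_cases h : p = q
  · simp [h]
  · rw [if_pos h, if_pos fun h' => h (hΦ hp hq h')]

/-- Energy of `m ^ d` shrunk copies of a configuration, one in each cell of the unit cube. -/
theorem exists_rieszEnergy_copies_le {s : ℝ} (hs : 0 < s) {m : ℕ} (hm : 1 ≤ m) {γ : ℝ}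
    (hγ : 0 ≤ γ) (hγ' : γ < 1) {ω : Finset (EuclideanSpace ℝ (Fin d))}
    (hω : (ω : Set _) ⊆ unitCube d)
    (hinj : Set.InjOn (fun u : EuclideanSpace ℝ (Fin d) => γ • u) ω) :
    ∃ ω' : Finset (EuclideanSpace ℝ (Fin d)), (ω' : Set _) ⊆ unitCube d ∧
      ω'.card = m ^ d * ω.card ∧
      rieszEnergy s ω' ≤ (m : ℝ) ^ d * (m : ℝ) ^ s * (rieszEnergy s ω / γ ^ s +
        (ω.card : ℝ) ^ 2 * (latticeSum d s m / (1 - γ) ^ s)) := by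
  classical
  have hm0 : (0 : ℝ) < m := by exact_mod_cast hm
  have h1γ : 0 < 1 - γ := by linarith
  have hΦ := injOn_cellMap hm hγ hγ' hω hinj
  refine ⟨(cellCorners d m ×ˢ ω).image (cellMap m γ), ?_, ?_, ?_⟩
  · intro x hx
    obtain ⟨⟨a, u⟩, hp, rfl⟩ := Finset.mem_image.1 (Finset.mem_coe.1 hx)
    obtain ⟨ha, hu⟩ := Finset.mem_product.1 hp
    exact cellMap_mem_unitCube hm hγ hγ' ha (hω hu)
  · rw [Finset.card_image_of_injOn hΦ, Finset.card_product, card_cellCorners]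
  rw [rieszEnergy_image s hΦ, Finset.sum_product]
  simp only [Finset.sum_product]
  -- Pairs in one cell reproduce the energy of ω exactly rescaled; pairs in different cells are
  -- bounded by the lattice term of their corners, whatever their positions in the cells.
  have hterm : ∀ b ∈ cellCorners d m, ∀ v ∈ ω, ∀ a ∈ cellCorners d m, ∀ u ∈ ω,
      (if (a, u) ≠ (b, v) then 1 / ‖cellMap m γ (a, u) - cellMap m γ (b, v)‖ ^ s else 0) ≤
        (if a = b then (m : ℝ) ^ s / γ ^ s * (if u ≠ v then 1 / ‖u - v‖ ^ s else 0) else 0) +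
        (if a ≠ b then (m : ℝ) ^ s / (1 - γ) ^ s * (1 / ‖latticePoint (a - b)‖ ^ s) else 0) := by
    intro b _ v hv a _ u hu
    by_cases hab : a = b
    · subst hab
      by_cases huv : u = v
      · simp [huv]
      · rw [if_pos (by simp [huv]), if_pos rfl, if_pos huv, if_neg (by simp), add_zero,
          norm_cellMap_sub_same m hγ, Real.mul_rpow (by positivity) (norm_nonneg _),
          Real.div_rpow hγ hm0.le, one_div, mul_inv, inv_div, one_div]
    · rw [if_pos (by simp [hab]), if_neg hab, if_pos hab, zero_add]
      have h0 := one_pos.trans_le (one_le_norm_latticePoint (sub_ne_zero.2 hab))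
      have h := norm_cellMap_sub_ge (m := m) hγ hγ' a b (hω hu) (hω hv)
      have h3 : 0 < (1 - γ) / m * ‖latticePoint (a - b)‖ := by positivity
      calc _ ≤ 1 / ((1 - γ) / m * ‖latticePoint (a - b)‖) ^ s := by gcongr
        _ = _ := by
          rw [Real.mul_rpow (by positivity) h0.le, Real.div_rpow h1γ.le hm0.le, one_div,
            mul_inv, inv_div, one_div]
  calc _ ≤ ∑ b ∈ cellCorners d m, ∑ v ∈ ω, ∑ a ∈ cellCorners d m, ∑ u ∈ ω,
        ((if a = b then (m : ℝ) ^ s / γ ^ s * (if u ≠ v then 1 / ‖u - v‖ ^ s else 0) else 0) +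
        (if a ≠ b then (m : ℝ) ^ s / (1 - γ) ^ s * (1 / ‖latticePoint (a - b)‖ ^ s) else 0)) :=
        Finset.sum_le_sum fun b hb => Finset.sum_le_sum fun v hv => Finset.sum_le_sum fun a ha =>
          Finset.sum_le_sum fun u hu => hterm b hb v hv a ha u hu
    _ = ∑ b ∈ cellCorners d m, ((m : ℝ) ^ s / γ ^ s * rieszEnergy s ω +
        (ω.card : ℝ) ^ 2 * ((m : ℝ) ^ s / (1 - γ) ^ s *
          ∑ a ∈ cellCorners d m with a ≠ b, 1 / ‖latticePoint (a - b)‖ ^ s)) := by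
        refine Finset.sum_congr rfl fun b hb => ?_
        simp only [Finset.sum_add_distrib]
        congr 1
        · rw [rieszEnergy, Finset.mul_sum]
          refine Finset.sum_congr rfl fun v _ => ?_
          rw [Finset.sum_comm, Finset.sum_filter, Finset.mul_sum]
          refine Finset.sum_congr rfl fun u _ => ?_
          rw [Finset.sum_ite_eq' _ b, if_pos hb]
        · simp only [Finset.sum_const, nsmul_eq_mul, ← Finset.mul_sum]
          rw [← Finset.sum_filter, ← Finset.mul_sum]
          ring
    _ ≤ ∑ b ∈ cellCorners d m, ((m : ℝ) ^ s / γ ^ s * rieszEnergy s ω +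
        (ω.card : ℝ) ^ 2 * ((m : ℝ) ^ s / (1 - γ) ^ s * latticeSum d s m)) := by
        refine Finset.sum_le_sum fun b hb => ?_
        gcongr
        exact sum_cellCorners_le_latticeSum s m b hb
    _ = _ := by
        rw [Finset.sum_const, card_cellCorners, nsmul_eq_mul]
        push_cast
        ring

end ScaledCopies

/-! ### Consequences for the minimal energy. -/

section MinimalEnergy

variable {d : ℕ}

theorem rieszEnergy_mono (s : ℝ) {ω ω' : Finset (EuclideanSpace ℝ (Fin d))} (h : ω ⊆ ω') :
    rieszEnergy s ω ≤ rieszEnergy s ω' := by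
  have hnn : ∀ x y : EuclideanSpace ℝ (Fin d), 0 ≤ 1 / ‖x - y‖ ^ s := fun x y => by positivity
  calc rieszEnergy s ω ≤ ∑ y ∈ ω, ∑ x ∈ ω' with x ≠ y, 1 / ‖x - y‖ ^ s :=
        Finset.sum_le_sum fun y _ => Finset.sum_le_sum_of_subset_of_nonneg
          (Finset.filter_subset_filter _ h) fun x _ _ => hnn x y
    _ ≤ _ := Finset.sum_le_sum_of_subset_of_nonneg h fun y _ _ =>
          Finset.sum_nonneg fun x _ => hnn x y

/-- Discarding points only lowers the energy. This allows arbitrary N although the constructions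
produce only special cardinalities. -/
theorem minEnergy_le_of_le_card {s : ℝ} {A : Set (EuclideanSpace ℝ (Fin d))}
    {ω : Finset (EuclideanSpace ℝ (Fin d))} (hω : (ω : Set _) ⊆ A) {N : ℕ} (hN : N ≤ ω.card) :
    minEnergy s A N ≤ ENNReal.ofReal (rieszEnergy s ω) := by
  obtain ⟨ω', hsub, hcard⟩ := Finset.exists_subset_card_eq hN
  refine (iInf₂_le_of_le ω' ((Finset.coe_subset.2 hsub).trans hω) (iInf_le _ hcard)).trans ?_
  exact ENNReal.ofReal_le_ofReal (rieszEnergy_mono s hsub)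

theorem zero_mem_unitCube (d : ℕ) : (0 : EuclideanSpace ℝ (Fin d)) ∈ unitCube d := by
  intro i
  simp

theorem minEnergy_le_grid {s : ℝ} (hs : 0 < s) {m : ℕ} (hm : 1 ≤ m) {M : ℕ} (hM : M ≤ m ^ d) :
    minEnergy s (unitCube d) M ≤
      ENNReal.ofReal ((m : ℝ) ^ d * (m : ℝ) ^ s * latticeSum d s m) := by
  -- With γ = 0 and ω = {0} the copies are the cell corners, a grid of spacing 1/m, and no factor
  -- (1-γ)^s is lost.
  obtain ⟨ω', h1, h2, h3⟩ := exists_rieszEnergy_copies_le (d := d) hs hm le_rfl zero_lt_one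
    (ω := {0}) (by simpa using zero_mem_unitCube d) (by simp)
  rw [Finset.card_singleton, mul_one] at h2
  refine (minEnergy_le_of_le_card h1 (hM.trans_eq h2.symm)).trans (ENNReal.ofReal_le_ofReal ?_)
  have h0 : rieszEnergy s ({0} : Finset (EuclideanSpace ℝ (Fin d))) = 0 := by
    rw [rieszEnergy, Finset.sum_singleton, Finset.filter_singleton]
    simp
  simpa [h0] using h3

theorem minEnergy_unitCube_ne_top (hd : 1 ≤ d) {s : ℝ} (hs : 0 < s) (N : ℕ) :
    minEnergy s (unitCube d) N ≠ ∞ := by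
  refine ne_top_of_le_ne_top ENNReal.ofReal_ne_top
    (minEnergy_le_grid hs (m := N + 1) (by omega) ?_)
  exact (Nat.le_succ N).trans (Nat.le_self_pow (by omega) _)

theorem exists_rieszEnergy_lt {s : ℝ} {A : Set (EuclideanSpace ℝ (Fin d))} {N : ℕ} {x : ℝ}
    (hA : minEnergy s A N ≠ ∞) (hx : (minEnergy s A N).toReal < x) :
    ∃ ω : Finset (EuclideanSpace ℝ (Fin d)), (ω : Set _) ⊆ A ∧ ω.card = N ∧
      rieszEnergy s ω < x := by
  have h := (ENNReal.lt_ofReal_iff_toReal_lt hA).2 hx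
  simp only [minEnergy, iInf_lt_iff] at h
  obtain ⟨ω, h1, h2, h3⟩ := h
  refine ⟨ω, h1, h2, ?_⟩
  exact (ENNReal.ofReal_lt_ofReal_iff (ENNReal.toReal_nonneg.trans_lt hx)).1 h3

theorem le_toReal_minEnergy {s : ℝ} {A : Set (EuclideanSpace ℝ (Fin d))} {N : ℕ} {c : ℝ}
    (hA : minEnergy s A N ≠ ∞)
    (h : ∀ ω : Finset (EuclideanSpace ℝ (Fin d)), (ω : Set _) ⊆ A → ω.card = N →
      c ≤ rieszEnergy s ω) : c ≤ (minEnergy s A N).toReal := by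
  rw [← ENNReal.ofReal_le_iff_le_toReal hA]
  exact le_iInf₂ fun ω h1 => le_iInf fun h2 => ENNReal.ofReal_le_ofReal (h ω h1 h2)

theorem minEnergy_copies_le (hd : 1 ≤ d) {s : ℝ} (hs : 0 < s) {C : ℝ}
    (hC : ∀ n, latticeSum d s n ≤ C) {N m M : ℕ} (hm : 1 ≤ m) (hM : M ≤ m ^ d * N) {γ : ℝ}
    (hγ : 0 < γ) (hγ' : γ < 1) :
    (minEnergy s (unitCube d) M).toReal ≤ (m : ℝ) ^ d * (m : ℝ) ^ s *
      ((minEnergy s (unitCube d) N).toReal / γ ^ s + (N : ℝ) ^ 2 * (C / (1 - γ) ^ s)) := by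
  have h1γ : 0 < 1 - γ := by linarith
  set e := (minEnergy s (unitCube d) N).toReal
  -- The infimum need not be known to be attained: bound with a configuration of energy below x,
  -- then let x decrease to e.
  have hlim : Tendsto (fun x : ℝ => (m : ℝ) ^ d * (m : ℝ) ^ s *
      (x / γ ^ s + (N : ℝ) ^ 2 * (C / (1 - γ) ^ s))) (𝓝[>] e) (𝓝 ((m : ℝ) ^ d * (m : ℝ) ^ s *
      (e / γ ^ s + (N : ℝ) ^ 2 * (C / (1 - γ) ^ s)))) := by
    refine Tendsto.mono_left (Continuous.tendsto ?_ e) nhdsWithin_le_nhds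
    fun_prop
  refine ge_of_tendsto hlim (eventually_mem_nhdsWithin.mono fun x hx => ?_)
  obtain ⟨ω, h1, h2, h3⟩ := exists_rieszEnergy_lt (minEnergy_unitCube_ne_top hd hs N) hx
  obtain ⟨ω', h4, h5, h6⟩ := exists_rieszEnergy_copies_le hs hm hγ.le hγ' h1
    (fun u _ v _ h => smul_right_injective _ hγ.ne' h)
  rw [h2] at h5 h6
  have h7 := minEnergy_le_of_le_card (s := s) h4 (hM.trans_eq h5.symm)
  refine (ENNReal.toReal_le_of_le_ofReal (rieszEnergy_nonneg s ω') h7).trans (h6.trans ?_)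
  gcongr
  exact hC m

end MinimalEnergy

/-! ### Existence of the limits. -/

section Limits

/-- The number of cells per side needed to accommodate `M` points with at least `N` per cell. -/
noncomputable def cellCount (d N M : ℕ) : ℕ := ⌈((M : ℝ) / N) ^ (1 / (d : ℝ))⌉₊

theorem one_le_cellCount {d N M : ℕ} (hN : 1 ≤ N) (hM : 1 ≤ M) : 1 ≤ cellCount d N M := by
  have hN0 : (0 : ℝ) < N := by exact_mod_cast hN
  have hM0 : (0 : ℝ) < M := by exact_mod_cast hM
  exact Nat.one_le_ceil_iff.2 (by positivity)

theorem le_cellCount_pow_mul {d N : ℕ} (hd : 1 ≤ d) (hN : 1 ≤ N) (M : ℕ) :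
    M ≤ cellCount d N M ^ d * N := by
  have hN0 : (0 : ℝ) < N := by exact_mod_cast hN
  have h := Nat.le_ceil (((M : ℝ) / N) ^ (1 / (d : ℝ)))
  have h2 := pow_le_pow_left₀ (by positivity) h d
  rw [one_div, Real.rpow_inv_natCast_pow (by positivity) (by omega), div_le_iff₀ hN0] at h2
  rw [← one_div] at h2
  exact_mod_cast h2

theorem tendsto_cellCount {d N : ℕ} (hd : 1 ≤ d) (hN : 1 ≤ N) :
    Tendsto (fun M : ℕ => ((cellCount d N M : ℝ) ^ d * N / M)) atTop (𝓝 1) := by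
  have hN0 : (0 : ℝ) < N := by exact_mod_cast hN
  have hd0 : (0 : ℝ) < d := by exact_mod_cast hd
  have h1 : Tendsto (fun M : ℕ => ((M : ℝ) / N) ^ (1 / (d : ℝ))) atTop atTop :=
    (tendsto_rpow_atTop (by positivity)).comp
      (tendsto_natCast_atTop_atTop.atTop_div_const hN0)
  have h2 := ((tendsto_nat_ceil_div_atTop (R := ℝ)).comp h1).pow d
  rw [one_pow] at h2
  refine h2.congr fun M => ?_
  simp only [Function.comp_apply, cellCount, div_pow]
  rw [one_div, Real.rpow_inv_natCast_pow (by positivity) (by omega), div_div_eq_mul_div]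

theorem tendsto_log_cellCount_div_log {d : ℕ} (hd : 1 ≤ d) :
    Tendsto (fun M : ℕ => Real.log (cellCount d 1 M) / Real.log M) atTop (𝓝 (1 / d)) := by
  have hd0 : (0 : ℝ) < d := by exact_mod_cast hd
  have hlogM : Tendsto (fun M : ℕ => Real.log (M : ℝ)) atTop atTop :=
    Real.tendsto_log_atTop.comp tendsto_natCast_atTop_atTop
  have h1 : Tendsto (fun M : ℕ => Real.log ((cellCount d 1 M : ℝ) ^ d * (1 : ℕ) / M)) atTop
      (𝓝 0) := by
    have := (Real.continuousAt_log one_ne_zero).tendsto.comp (tendsto_cellCount hd le_rfl)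
    rwa [Real.log_one] at this
  have h2 := ((h1.div_atTop hlogM).add_const 1).div_const (d : ℝ)
  rw [zero_add] at h2
  refine h2.congr' ?_
  filter_upwards [eventually_ge_atTop 2] with M hM
  have hM0 : (1 : ℝ) < M := by exact_mod_cast hM
  have hm : (0 : ℝ) < cellCount d 1 M := by
    exact_mod_cast one_le_cellCount (d := d) le_rfl (by omega : 1 ≤ M)
  have hlog : 0 < Real.log M := Real.log_pos hM0
  rw [Nat.cast_one, mul_one, Real.log_div (by positivity) (by positivity), Real.log_pow]
  field_simp
  ring

/-- An approximate monotonicity argument: fixed N and γ bound the limsup L by a N / γ^s plus an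
error that vanishes as N → ∞, because s > d. Taking γ near 1 gives L ≤ liminf a; positivity is the
one-parameter Gaussian bound. -/
theorem exists_tendsto_supercritical {d : ℕ} (hd : 1 ≤ d) {s : ℝ} (hs : (d : ℝ) < s) :
    ∃ g : ℝ, 0 < g ∧ Tendsto (fun N : ℕ => (minEnergy s (unitCube d) N).toReal /
      (N : ℝ) ^ (1 + s / d)) atTop (𝓝 g) := by
  have hpi := Real.pi_pos
  have hd0 : (0 : ℝ) < d := by exact_mod_cast hd
  have hs0 : 0 < s := hd0.trans hs
  obtain ⟨C, hC⟩ := exists_latticeSum_le hd hs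
  set e : ℕ → ℝ := fun N => (minEnergy s (unitCube d) N).toReal
  set p : ℝ := 1 + s / d with hp
  have hsd : 1 < s / d := (one_lt_div hd0).2 hs
  have hp0 : 0 < p := by linarith
  set a : ℕ → ℝ := fun N => e N / (N : ℝ) ^ p
  have ha0 : ∀ N, 0 ≤ a N := fun N => div_nonneg ENNReal.toReal_nonneg (by positivity)
  have hupper : ∀ N : ℕ, 1 ≤ N → ∀ γ : ℝ, 0 < γ → γ < 1 → ∃ b : ℕ → ℝ,
      (∀ᶠ M in atTop, a M ≤ b M) ∧
      Tendsto b atTop (𝓝 (a N / γ ^ s + C / (1 - γ) ^ s * (N : ℝ) ^ (1 - s / d))) := by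
    intro N hN γ hγ hγ'
    have hN0 : (0 : ℝ) < N := by exact_mod_cast hN
    set K := a N / γ ^ s + C / (1 - γ) ^ s * (N : ℝ) ^ (1 - s / d) with hK
    -- The intercell term is quadratic in N, hence N^(1-s/d) relative to the normalization N^p.
    have hKe : e N / γ ^ s + (N : ℝ) ^ 2 * (C / (1 - γ) ^ s) = K * (N : ℝ) ^ p := by
      have h1 : a N * (N : ℝ) ^ p = e N := div_mul_cancel₀ _ (by positivity)
      have h2 : (N : ℝ) ^ (1 - s / d) * (N : ℝ) ^ p = (N : ℝ) ^ 2 := by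
        rw [← Real.rpow_add hN0, ← Real.rpow_two]
        congr 1
        rw [hp]
        ring
      rw [hK, add_mul, mul_assoc, h2, div_mul_eq_mul_div, h1]
      ring
    refine ⟨fun M => ((cellCount d N M : ℝ) ^ d * N / M) ^ p * K, ?_, ?_⟩
    · filter_upwards [eventually_ge_atTop 1] with M hM
      have hM0 : (0 : ℝ) < M := by exact_mod_cast hM
      have h := minEnergy_copies_le hd hs0 hC (one_le_cellCount hN hM)
        (le_cellCount_pow_mul hd hN M) hγ hγ'
      change e M ≤ (cellCount d N M : ℝ) ^ d * (cellCount d N M : ℝ) ^ s *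
        (e N / γ ^ s + (N : ℝ) ^ 2 * (C / (1 - γ) ^ s)) at h
      have hm0 : (0 : ℝ) < cellCount d N M := by exact_mod_cast one_le_cellCount hN hM
      have hmp : (cellCount d N M : ℝ) ^ d * (cellCount d N M : ℝ) ^ s =
          ((cellCount d N M : ℝ) ^ d) ^ p := by
        rw [← Real.rpow_natCast, ← Real.rpow_add hm0, ← Real.rpow_mul hm0.le]
        congr 1
        rw [hp]
        field_simp
      rw [hKe, hmp] at h
      show e M / (M : ℝ) ^ p ≤ _
      rw [Real.div_rpow (by positivity) hM0.le, Real.mul_rpow (by positivity) hN0.le,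
        div_mul_eq_mul_div]
      gcongr
      linarith
    · have h := (tendsto_cellCount hd hN).rpow_const (p := p) (Or.inl one_ne_zero)
      simpa using h.mul_const K
  have hbdd : IsBoundedUnder (· ≤ ·) atTop a := by
    obtain ⟨b, hb, hlim⟩ := hupper 1 le_rfl (1 / 2) (by norm_num) (by norm_num)
    exact hlim.isBoundedUnder_le.mono_le hb
  have hcob : IsCoboundedUnder (· ≤ ·) atTop a :=
    (isBoundedUnder_of ⟨0, ha0⟩ : IsBoundedUnder (· ≥ ·) atTop a).isCoboundedUnder_le
  set L := limsup a atTop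
  have hL : ∀ N : ℕ, 1 ≤ N → ∀ γ : ℝ, 0 < γ → γ < 1 →
      L ≤ a N / γ ^ s + C / (1 - γ) ^ s * (N : ℝ) ^ (1 - s / d) := by
    intro N hN γ hγ hγ'
    obtain ⟨b, hb, hlim⟩ := hupper N hN γ hγ hγ'
    rw [← hlim.limsup_eq]
    exact limsup_le_limsup hb hcob hlim.isBoundedUnder_le
  have htend : Tendsto a atTop (𝓝 L) := by
    refine tendsto_order.2 ⟨fun c hc => ?_, fun c hc => eventually_lt_of_limsup_lt hc hbdd⟩
    -- Here γ is fixed before N: the error constant C/(1-γ)^s blows up as γ → 1 and must be absorbed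
    -- by N.
    obtain ⟨γ, hγc, hγ, hγ'⟩ : ∃ γ : ℝ, c < γ ^ s * L ∧ 0 < γ ∧ γ < 1 := by
      have h1 : Tendsto (fun γ : ℝ => γ ^ s * L) (𝓝[<] 1) (𝓝 (1 ^ s * L)) :=
        Tendsto.mono_left (((Real.continuousAt_rpow_const 1 s (Or.inl one_ne_zero)).mul_const
          L).tendsto) nhdsWithin_le_nhds
      rw [Real.one_rpow, one_mul] at h1
      have h2 : ∀ᶠ γ : ℝ in 𝓝[<] 1, 0 < γ ∧ γ < 1 := Ioo_mem_nhdsLT one_pos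
      exact ((h1.eventually (lt_mem_nhds hc)).and h2).exists
    have h1 : Tendsto (fun N : ℕ => γ ^ s * (L - C / (1 - γ) ^ s * (N : ℝ) ^ (1 - s / d))) atTop
        (𝓝 (γ ^ s * (L - C / (1 - γ) ^ s * 0))) := by
      have h2 : Tendsto (fun N : ℕ => (N : ℝ) ^ (1 - s / d)) atTop (𝓝 0) := by
        have := (tendsto_rpow_neg_atTop (show 0 < s / d - 1 by linarith)).comp
          (tendsto_natCast_atTop_atTop (R := ℝ))
        simpa [Function.comp_def] using this
      exact ((h2.const_mul _).const_sub _).const_mul _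
    rw [mul_zero, sub_zero] at h1
    filter_upwards [h1.eventually (lt_mem_nhds hγc), eventually_ge_atTop 1] with N h2 hN
    refine h2.trans_le ?_
    have h3 := hL N hN γ hγ hγ'
    have hγs : 0 < γ ^ s := by positivity
    have h4 : a N = γ ^ s * (a N / γ ^ s) := by field_simp
    rw [h4]
    exact mul_le_mul_of_nonneg_left (by linarith) hγs.le
  refine ⟨L, ?_, htend⟩
  obtain ⟨T, hT, hgauss⟩ := exists_sum_gaussian_ge d (show (0 : ℝ) < 1 / 2 by norm_num)
  have hc : 0 < Real.pi ^ (s / 2) / (4 ^ (s / d) * (s / 2) ^ (s / 2)) := by positivity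
  refine hc.trans_le (ge_of_tendsto htend ?_)
  have hlarge : Tendsto (fun N : ℕ => Real.pi * ((N : ℝ) / 4) ^ (2 / (d : ℝ))) atTop atTop :=
    ((tendsto_rpow_atTop (by positivity)).comp
      (tendsto_natCast_atTop_atTop.atTop_div_const (by norm_num))).const_mul_atTop hpi
  filter_upwards [hlarge.eventually_ge_atTop T, eventually_ge_atTop 1] with N hN hN1
  have hN0 : (0 : ℝ) < N := by exact_mod_cast hN1
  show _ ≤ e N / (N : ℝ) ^ p
  rw [le_div_iff₀ (by positivity)]
  refine le_toReal_minEnergy (minEnergy_unitCube_ne_top hd hs0 N) fun ω hω hcard => ?_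
  subst hcard
  exact rieszEnergy_supercritical_ge hd hs0 hgauss ω hω hN hN1

/-- The grid is asymptotically optimal here. With m^d ~ M its energy is at most about m^(2d) · d g
log m, and log m ~ (log M)/d leaves exactly g M² log M. -/
theorem tendsto_critical {d : ℕ} (hd : 1 ≤ d) :
    Tendsto (fun N : ℕ => (minEnergy d (unitCube d) N).toReal / ((N : ℝ) ^ 2 * Real.log N)) atTop
      (𝓝 (2 * Real.pi ^ ((d : ℝ) / 2) / (d * Real.Gamma ((d : ℝ) / 2)))) := by
  have hpi := Real.pi_pos
  have hd0 : (0 : ℝ) < d := by exact_mod_cast hd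
  have hG : 0 < Real.Gamma ((d : ℝ) / 2) := Real.Gamma_pos_of_pos (by positivity)
  set g := 2 * Real.pi ^ ((d : ℝ) / 2) / (d * Real.Gamma ((d : ℝ) / 2)) with hg
  have hg0 : 0 < g := by positivity
  have hlogM : Tendsto (fun M : ℕ => Real.log (M : ℝ)) atTop atTop :=
    Real.tendsto_log_atTop.comp tendsto_natCast_atTop_atTop
  refine tendsto_order.2 ⟨fun c hc => ?_, fun c hc => ?_⟩
  · obtain ⟨η, hη, hηc⟩ : ∃ η : ℝ, 0 < η ∧ c < (1 - η) * g := by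
      -- This η makes (1 - η)g the midpoint of c and g.
      refine ⟨(g - c) / (2 * g), by have := sub_pos.2 hc; positivity, ?_⟩
      have : (1 - (g - c) / (2 * g)) * g = (g + c) / 2 := by field_simp; ring
      rw [this]
      linarith
    obtain ⟨T, hT, hgauss⟩ := exists_sum_gaussian_ge d hη
    have hlim : Tendsto (fun N : ℕ => (1 - η) * g -
        ((1 - η) * Real.pi ^ ((d : ℝ) / 2) * Real.log T + 2 / d) /
          Real.Gamma ((d : ℝ) / 2) / Real.log N) atTop (𝓝 ((1 - η) * g - 0)) :=
      (hlogM.const_div_atTop _).const_sub _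
    rw [sub_zero] at hlim
    have hlarge : Tendsto (fun N : ℕ => (N : ℝ) ^ (2 / (d : ℝ))) atTop atTop :=
      (tendsto_rpow_atTop (by positivity)).comp tendsto_natCast_atTop_atTop
    filter_upwards [hlim.eventually (lt_mem_nhds hηc), hlarge.eventually_ge_atTop T,
      eventually_ge_atTop 2] with N h1 h2 hN
    have hN0 : (1 : ℝ) < N := by exact_mod_cast hN
    have hlog : 0 < Real.log N := Real.log_pos hN0
    refine h1.trans_le ?_
    rw [le_div_iff₀ (by positivity)]
    refine le_toReal_minEnergy (minEnergy_unitCube_ne_top hd hd0 N) fun ω hω hcard => ?_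
    subst hcard
    have h := rieszEnergy_critical_ge hd hT hgauss ω hω h2 (by omega)
    refine le_of_mul_le_mul_left (le_trans (le_of_eq ?_) h) hG
    rw [hg]
    field_simp
    ring
  · obtain ⟨C, hC⟩ := exists_latticeSum_critical_le hd
    have hlim : Tendsto (fun M : ℕ => ((cellCount d 1 M : ℝ) ^ d * (1 : ℕ) / M) ^ 2 *
        (d * g * (Real.log (cellCount d 1 M) / Real.log M) + C / Real.log M)) atTop
        (𝓝 (1 ^ 2 * (d * g * (1 / d) + 0))) :=
      ((tendsto_cellCount hd le_rfl).pow 2).mul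
        (((tendsto_log_cellCount_div_log hd).const_mul _).add (hlogM.const_div_atTop C))
    have hval : (1 : ℝ) ^ 2 * (d * g * (1 / d) + 0) = g := by field_simp; ring
    rw [hval] at hlim
    filter_upwards [hlim.eventually (gt_mem_nhds hc), eventually_ge_atTop 2] with M h1 hM
    refine lt_of_le_of_lt ?_ h1
    have hM0 : (1 : ℝ) < M := by exact_mod_cast hM
    have hlog : 0 < Real.log M := Real.log_pos hM0
    have hm := one_le_cellCount (d := d) le_rfl (by omega : 1 ≤ M)
    have hMle := le_cellCount_pow_mul hd le_rfl M
    rw [mul_one] at hMle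
    set m := cellCount d 1 M
    have h2 := ENNReal.toReal_le_of_le_ofReal
      (mul_nonneg (by positivity) (latticeSum_nonneg d d m)) (minEnergy_le_grid hd0 hm hMle)
    have h3 : 2 * Real.pi ^ ((d : ℝ) / 2) / Real.Gamma ((d : ℝ) / 2) = d * g := by
      rw [hg]
      field_simp
    have h4 := hC m hm
    rw [h3] at h4
    rw [Real.rpow_natCast] at h2
    have h5 : (minEnergy d (unitCube d) M).toReal ≤
        (m : ℝ) ^ d * (m : ℝ) ^ d * (d * g * Real.log m + C) :=
      h2.trans (by gcongr)
    rw [div_le_iff₀ (by positivity)]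
    refine h5.trans (le_of_eq ?_)
    push_cast
    field_simp

end Limits

/-! ### The volume of the unit ball and the conclusion. -/

theorem euclideanHausdorffMeasure_closedBall_one {d : ℕ} (hd : 1 ≤ d) :
    μHE[d] (Metric.closedBall (0 : EuclideanSpace ℝ (Fin d)) 1) =
      ENNReal.ofReal (2 * Real.pi ^ ((d : ℝ) / 2) / (d * Real.Gamma ((d : ℝ) / 2))) := by
  have hd0 : (0 : ℝ) < d := by exact_mod_cast hd
  have : Nonempty (Fin d) := ⟨⟨0, hd⟩⟩
  rw [EuclideanSpace.euclideanHausdorffMeasure_eq_volume, EuclideanSpace.volume_closedBall,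
    Fintype.card_fin, ENNReal.ofReal_one, one_pow, one_mul, Real.Gamma_add_one (by positivity),
    Real.sqrt_eq_rpow, ← Real.rpow_natCast, ← Real.rpow_mul Real.pi_pos.le]
  congr 1
  rw [one_div_mul_eq_div]
  field_simp

theorem theorem4p1 (d : ℕ) (hd : 1 ≤ d) (s : ℝ) (hs : (d : ℝ) ≤ s) :
    ∃ g : ℝ≥0∞, 0 < g ∧ g < ∞ ∧
      Tendsto (fun N : ℕ => normalizedMinEnergy s d (unitCube d) N) atTop (𝓝 g) ∧
      (s = d →
        g = μHE[d] (Metric.closedBall (0 : EuclideanSpace ℝ (Fin d)) 1) ∧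
        μHE[d] (Metric.closedBall (0 : EuclideanSpace ℝ (Fin d)) 1) =
          ENNReal.ofReal (2 * Real.pi ^ ((d : ℝ) / 2) / (d * Real.Gamma ((d : ℝ) / 2)))) := by
  have hpi := Real.pi_pos
  have hd0 : (0 : ℝ) < d := by exact_mod_cast hd
  have hs0 : 0 < s := hd0.trans_le hs
  have hG : 0 < Real.Gamma ((d : ℝ) / 2) := Real.Gamma_pos_of_pos (by positivity)
  obtain ⟨g, hg0, hlim, hval⟩ : ∃ g : ℝ, 0 < g ∧
      Tendsto (fun N : ℕ => (minEnergy s (unitCube d) N).toReal / tau s d N) atTop (𝓝 g) ∧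
      (s = d → g = 2 * Real.pi ^ ((d : ℝ) / 2) / (d * Real.Gamma ((d : ℝ) / 2))) := by
    rcases hs.eq_or_lt with rfl | hlt
    · refine ⟨_, ?_, by simpa [tau] using tendsto_critical hd, fun _ => rfl⟩
      positivity
    · obtain ⟨g, hg0, hlim⟩ := exists_tendsto_supercritical hd hlt
      exact ⟨g, hg0, by simpa [tau, hlt] using hlim, fun h => absurd h hlt.ne'⟩
  refine ⟨ENNReal.ofReal g, ENNReal.ofReal_pos.2 hg0, ENNReal.ofReal_lt_top, ?_, fun h => ?_⟩
  · refine (ENNReal.tendsto_ofReal hlim).congr' ?_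
    -- For N = 1 and s = d the normalization is 0; from N = 2 on it is positive, and real and
    -- extended quotients agree.
    filter_upwards [eventually_ge_atTop 2] with N hN
    have hN0 : (1 : ℝ) < N := by exact_mod_cast hN
    have htau : 0 < tau s d N := by
      have := Real.log_pos hN0
      unfold tau
      split_ifs <;> positivity
    rw [ENNReal.ofReal_div_of_pos htau,
      ENNReal.ofReal_toReal (minEnergy_unitCube_ne_top hd hs0 N), normalizedMinEnergy]
  · rw [hval h]
    exact ⟨(euclideanHausdorffMeasure_closedBall_one hd).symm,
      euclideanHausdorffMeasure_closedBall_one hd⟩
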